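/- All vector spaces are real. For $m\ge 1$ let $\mathcal H_m$ be the vector lattice of continuous, positively homogeneous functions $\mathbb R^m\to\mathbb R$. For elements $x_1,\dots,x_m$ of a Banach lattice $X$ and $h\in\mathcal H_m$, $h(x_1,\dots,x_m)\in X$ denotes the image of $h$ under the unique lattice homomorphism $\mathcal H_m\to X$ which maps the $k$-th coordinate projection to $x_k$ for each $k$. A *convexity condition* is a triple $\mathcal D=(\mathcal G,M,\vartheta)$, where $\mathcal G$ is a nonempty set of functions, each belonging to $\mathcal H_m$ for some $m\ge1$ and monotone on $\mathbb R^m_+$, and $M\colon\mathcal G\to[1,\infty)$ and $\vartheta\colon\mathcal G\to\{0,1\}$ are arbitrary functions. A lattice seminorm $\nu$ is *$\mathcal D$-convex* if $$\nu\bigl(g(x_1,\dots,x_m)\bigr)\le M(g)\, g\bigl(\nu(x_1),\dots,\nu(x_m)\bigr)$$ for every $m\ge1$, every $g\in\mathcal G\cap\mathcal H_m$ and all positive $x_1,\dots,x_m$, which are in addition required to be pairwise disjoint if $\vartheta(g)=0$. A Banach lattice is *$\mathcal D$-convex* if its norm is. For a Banach space $E$ with closed dual unit ball $B_{E^*}$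 and $x\in E$, let $\delta_x\colon B_{E^*}\to\mathbb R$, $\delta_x(x^*)=x^*(x)$, and let $Y_0$ be the vector lattice (with pointwise operations and pointwise function calculus) of all functions $h(\delta_{x_1},\dots,\delta_{x_m})$ with $m\ge 1$, $h\in\mathcal H_m$, $x_1,\dots,x_m\in E$. The *free $\mathcal D$-convex Banach lattice* $\mathrm{FBL}^{\mathcal D}[E]$ is the completion of $Y_0$ with respect to the norm $\|f\|_{\mathcal D}=\sup_\nu \nu(f)$, where the supremum is over all $\mathcal D$-convex lattice seminorms $\nu$ on $Y_0$ with $\nu(\delta_x)\le\|x\|$ for all $x\in E$. **Theorem.** Let $\mathcal D$ be a convexity condition. The Banach lattice $\mathrm{FBL}^{\mathcal D}[\ell_1]$ is projectively universal for the class of separable, $\mathcal D$-convex Banach lattices. That is, $\mathrm{FBL}^{\mathcal D}[\ell_1]$ is separable and $\mathcal D$-convex, and for every separable, $\mathcal D$-convex Banach lattice $X$ there is a closed ideal $J$ of $\mathrm{FBL}^{\mathcal D}[\ell_1]$ such that $X$ is lattice isometric to the quotient $\mathrm{FBL}^{\mathcal D}[\ell_1]/J$. -/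

import Mathlib

set_option linter.unusedSectionVars false

noncomputable section

namespace FreeBL

/-- A (real) Banach lattice: a complete normed space which is a vector lattice and whose norm is
a lattice norm, that is, `|x| ≤ |y|` implies `‖x‖ ≤ ‖y‖`. -/
class BanachLattice (X : Type*) [NormedAddCommGroup X] [NormedSpace ℝ X] [Lattice X] : Prop
    extends IsOrderedAddMonoid X, IsOrderedModule ℝ X, HasSolidNorm X, CompleteSpace X

/-- A linear map between vector lattices is a lattice homomorphism if it preserves the two lattice
operations. -/
def IsLatticeHom {X Y : Type*} [AddCommGroup X] [Module ℝ X] [Lattice X]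
    [AddCommGroup Y] [Module ℝ Y] [Lattice Y] (T : X →ₗ[ℝ] Y) : Prop :=
  (∀ x y, T (x ⊔ y) = T x ⊔ T y) ∧ ∀ x y, T (x ⊓ y) = T x ⊓ T y

/-! ### Positively homogeneous continuous function calculus -/

/-- The space of continuous, positively homogeneous, real-valued functions on `ℝ^m`. -/
def H (m : ℕ) : Submodule ℝ C(Fin m → ℝ, ℝ) where
  carrier := {h | ∀ r : ℝ, 0 ≤ r → ∀ t, h (r • t) = r * h t}
  zero_mem' := by intro r _ t; simp
  add_mem' := by
    intro f g hf hg r hr t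
    simp only [ContinuousMap.add_apply, hf r hr t, hg r hr t]; ring
  smul_mem' := by
    intro c f hf r hr t
    simp only [ContinuousMap.smul_apply, hf r hr t, smul_eq_mul]; ring

/-- `H m` is a vector lattice under the pointwise order. -/
instance (m : ℕ) : Lattice (H m) :=
  Subtype.lattice
    (by
      intro f g hf hg r hr t
      simp only [ContinuousMap.sup_apply, hf r hr t, hg r hr t, mul_max_of_nonneg _ _ hr])
    (by
      intro f g hf hg r hr t
      simp only [ContinuousMap.inf_apply, hf r hr t, hg r hr t, mul_min_of_nonneg _ _ hr])

instance (m : ℕ) : CoeFun (H m) (fun _ => (Fin m → ℝ) → ℝ) := ⟨fun h => h.1⟩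

theorem H.sup_apply {m : ℕ} (f g : H m) (t : Fin m → ℝ) : (f ⊔ g) t = f t ⊔ g t := rfl
theorem H.inf_apply {m : ℕ} (f g : H m) (t : Fin m → ℝ) : (f ⊓ g) t = f t ⊓ g t := rfl
theorem H.add_apply {m : ℕ} (f g : H m) (t : Fin m → ℝ) : (f + g) t = f t + g t := rfl
theorem H.sub_apply {m : ℕ} (f g : H m) (t : Fin m → ℝ) : (f - g) t = f t - g t := rfl
theorem H.smul_apply {m : ℕ} (c : ℝ) (f : H m) (t : Fin m → ℝ) : (c • f) t = c * f t := rfl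
theorem H.map_smul {m : ℕ} (f : H m) {r : ℝ} (hr : 0 ≤ r) (t : Fin m → ℝ) :
    f (r • t) = r * f t := f.2 r hr t
theorem H.ext' {m : ℕ} {f g : H m} (h : ∀ t, f t = g t) : f = g :=
  Subtype.ext (ContinuousMap.ext h)

/-- The `k`-th coordinate projection, as an element of `H m`. -/
def H.proj {m : ℕ} (k : Fin m) : H m :=
  ⟨⟨fun t => t k, continuous_apply k⟩, fun _ _ _ => rfl⟩

theorem H.proj_apply {m : ℕ} (k : Fin m) (t : Fin m → ℝ) : H.proj k t = t k := rfl

/-- A positively homogeneous continuous function calculus on a vector lattice `X`: for every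
`m`-tuple `x` in `X` a lattice homomorphism `H m → X` which maps the `k`-th coordinate projection
to `x k`. -/
structure FunctionCalculus (X : Type*) [AddCommGroup X] [Module ℝ X] [Lattice X] where
  /-- `Φ x h` is the element usually written `h(x_1, …, x_m)`. -/
  Φ : ∀ {m : ℕ}, (Fin m → X) → H m →ₗ[ℝ] X
  isLatticeHom : ∀ {m : ℕ} (x : Fin m → X), IsLatticeHom (Φ x)
  map_proj : ∀ {m : ℕ} (x : Fin m → X) (k : Fin m), Φ x (H.proj k) = x k

/-! ### Every Banach lattice admits a positively homogeneous continuous function calculus -/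

section Existence

variable {X : Type*} [NormedAddCommGroup X] [NormedSpace ℝ X] [Lattice X] [BanachLattice X]
  {m : ℕ}

/-- `Cvx x p y`: both `p` and `y` are the maximum of the same finitely many linear forms, evaluated
on `ℝ^m` and at the tuple `x`, respectively. -/
def Cvx (x : Fin m → X) (p : H m) (y : X) : Prop :=
  ∃ B : Set (Fin m → ℝ), B.Finite ∧ B.Nonempty ∧
    (∀ t, IsLUB (Fintype.linearCombination ℝ t '' B) (p t)) ∧
    IsLUB (Fintype.linearCombination ℝ x '' B) y

theorem Cvx.mono {x : Fin m → X} {p q : H m} {y z : X} (hp : Cvx x p y) (hq : Cvx x q z)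
    (h : ∀ t, p t ≤ q t) : y ≤ z := by
  obtain ⟨A, hAf, hAn, hA, hAx⟩ := hp
  obtain ⟨B, hBf, hBn, hB, hBx⟩ := hq
  refine hAx.2 ?_
  rintro _ ⟨a, ha, rfl⟩
  have hmem : a ∈ convexHull ℝ B := by
    by_contra hnot
    obtain ⟨f, u, hf, hu⟩ := geometric_hahn_banach_closed_point (convex_convexHull ℝ B)
      (hBf.isCompact_convexHull (𝕜 := ℝ)).isClosed hnot
    have key : ∀ c : Fin m → ℝ,
        Fintype.linearCombination ℝ (fun i => f (Pi.single i 1)) c = f c := by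
      intro c
      rw [Fintype.linearCombination_apply]
      conv_rhs => rw [← Finset.univ_sum_single c, map_sum]
      refine Finset.sum_congr rfl fun i _ => ?_
      rw [← _root_.map_smul]
      congr 1
      ext j
      by_cases hj : j = i
      · subst hj; simp
      · simp [hj]
    set t : Fin m → ℝ := fun i => f (Pi.single i 1)
    have h1 : f a ≤ p t := by
      rw [← key a]; exact (hA t).1 ⟨a, ha, rfl⟩
    have h2 : q t ≤ u := by
      refine (hB t).2 ?_
      rintro _ ⟨b, hb, rfl⟩
      rw [key b]
      exact (hf b (subset_convexHull ℝ B hb)).le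
    linarith [h t]
  have hconv : Convex ℝ {c : Fin m → ℝ | Fintype.linearCombination ℝ x c ≤ z} :=
    (convex_Iic z).linear_preimage (Fintype.linearCombination ℝ x)
  exact convexHull_min (fun b hb => hBx.1 ⟨b, hb, rfl⟩) hconv hmem

theorem Cvx.add {x : Fin m → X} {p q : H m} {y z : X} (hp : Cvx x p y) (hq : Cvx x q z) :
    Cvx x (p + q) (y + z) := by
  obtain ⟨A, hAf, hAn, hA, hAx⟩ := hp
  obtain ⟨B, hBf, hBn, hB, hBx⟩ := hq
  open Pointwise in
  refine ⟨A + B, hAf.add hBf, hAn.add hBn, fun t => ?_, ?_⟩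
  · rw [Set.image_add]; exact (hA t).add (hB t)
  · rw [Set.image_add]; exact hAx.add hBx

theorem Cvx.sup {x : Fin m → X} {p q : H m} {y z : X} (hp : Cvx x p y) (hq : Cvx x q z) :
    Cvx x (p ⊔ q) (y ⊔ z) := by
  obtain ⟨A, hAf, hAn, hA, hAx⟩ := hp
  obtain ⟨B, hBf, hBn, hB, hBx⟩ := hq
  refine ⟨A ∪ B, hAf.union hBf, hAn.inl, fun t => ?_, ?_⟩
  · rw [Set.image_union]; exact (hA t).union (hB t)
  · rw [Set.image_union]; exact hAx.union hBx

theorem Cvx.zero (x : Fin m → X) : Cvx x 0 0 := by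
  refine ⟨{0}, Set.finite_singleton _, Set.singleton_nonempty _, fun t => ?_, ?_⟩
  · simp
  · simp

theorem isLUB_smul {Y : Type*} [AddCommGroup Y] [Module ℝ Y] [PartialOrder Y] [PosSMulMono ℝ Y]
    {m : ℕ} {A : Set (Fin m → ℝ)} {r : ℝ} (hr : 0 < r) (t : Fin m → Y) (s : Y)
    (hs : IsLUB (Fintype.linearCombination ℝ t '' A) s) :
    IsLUB (Fintype.linearCombination ℝ t '' ((fun c => r • c) '' A)) (r • s) := by
  constructor
  · rintro _ ⟨_, ⟨a, ha, rfl⟩, rfl⟩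
    simp only [_root_.map_smul]
    exact smul_le_smul_of_nonneg_left (hs.1 ⟨a, ha, rfl⟩) hr.le
  · intro w hw
    have : s ≤ r⁻¹ • w := by
      refine hs.2 ?_
      rintro _ ⟨a, ha, rfl⟩
      have := hw ⟨_, ⟨a, ha, rfl⟩, rfl⟩
      simp only [_root_.map_smul] at this
      have := smul_le_smul_of_nonneg_left this (inv_nonneg.2 hr.le)
      rwa [inv_smul_smul₀ hr.ne'] at this
    have := smul_le_smul_of_nonneg_left this hr.le
    rwa [smul_inv_smul₀ hr.ne'] at this

theorem Cvx.smul {x : Fin m → X} {p : H m} {y : X} {r : ℝ} (hr : 0 ≤ r) (hp : Cvx x p y) :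
    Cvx x (r • p) (r • y) := by
  rcases hr.eq_or_lt with rfl | hr
  · simpa using Cvx.zero x
  obtain ⟨A, hAf, hAn, hA, hAx⟩ := hp
  exact ⟨(fun c => r • c) '' A, hAf.image _, hAn.image _, fun t => isLUB_smul hr t _ (hA t),
    isLUB_smul hr x y hAx⟩

theorem Cvx.proj (x : Fin m → X) (k : Fin m) (s : ℝ) : Cvx x (s • H.proj k) (s • x k) := by
  refine ⟨{Pi.single k s}, Set.finite_singleton _, Set.singleton_nonempty _, fun t => ?_, ?_⟩
  · rw [Set.image_singleton, Fintype.linearCombination_apply_single]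
    exact isLUB_singleton
  · rw [Set.image_singleton, Fintype.linearCombination_apply_single]
    exact isLUB_singleton

/-- `Rel x h y`: the function `h` is built from the coordinate projections by linear and lattice
operations, and `y` is obtained from the tuple `x` by the same operations. -/
def Rel (x : Fin m → X) (h : H m) (y : X) : Prop :=
  ∃ p q : H m, ∃ u v : X, Cvx x p u ∧ Cvx x q v ∧ h = p - q ∧ y = u - v

theorem Rel.mono {x : Fin m → X} {h k : H m} {y z : X} (hh : Rel x h y) (hk : Rel x k z)
    (hle : ∀ t, h t ≤ k t) : y ≤ z := by
  obtain ⟨p, q, u, v, hp, hq, rfl, rfl⟩ := hh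
  obtain ⟨p', q', u', v', hp', hq', rfl, rfl⟩ := hk
  have := (hp.add hq').mono (hp'.add hq) (fun t => by
    have := hle t
    rw [H.sub_apply, H.sub_apply] at this
    rw [H.add_apply, H.add_apply]; linarith)
  rw [sub_le_sub_iff]; exact this

theorem Rel.add {x : Fin m → X} {h k : H m} {y z : X} (hh : Rel x h y) (hk : Rel x k z) :
    Rel x (h + k) (y + z) := by
  obtain ⟨p, q, u, v, hp, hq, rfl, rfl⟩ := hh
  obtain ⟨p', q', u', v', hp', hq', rfl, rfl⟩ := hk
  exact ⟨p + p', q + q', u + u', v + v', hp.add hp', hq.add hq', by abel, by abel⟩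

theorem Rel.smul {x : Fin m → X} {h : H m} {y : X} (r : ℝ) (hh : Rel x h y) :
    Rel x (r • h) (r • y) := by
  obtain ⟨p, q, u, v, hp, hq, rfl, rfl⟩ := hh
  rcases le_total 0 r with hr | hr
  · exact ⟨r • p, r • q, r • u, r • v, hp.smul hr, hq.smul hr, smul_sub .., smul_sub ..⟩
  · refine ⟨(-r) • q, (-r) • p, (-r) • v, (-r) • u, hq.smul (neg_nonneg.2 hr),
      hp.smul (neg_nonneg.2 hr), ?_, ?_⟩ <;> module

theorem Rel.sup {x : Fin m → X} {h k : H m} {y z : X} (hh : Rel x h y) (hk : Rel x k z) :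
    Rel x (h ⊔ k) (y ⊔ z) := by
  obtain ⟨p, q, u, v, hp, hq, rfl, rfl⟩ := hh
  obtain ⟨p', q', u', v', hp', hq', rfl, rfl⟩ := hk
  refine ⟨(p + q') ⊔ (p' + q), q + q', (u + v') ⊔ (u' + v), v + v',
    (hp.add hq').sup (hp'.add hq), hq.add hq', ?_, ?_⟩
  · refine H.ext' fun t => ?_
    simp only [H.sub_apply, H.sup_apply, H.add_apply]
    rw [← max_sub_sub_right]; congr 1 <;> ring
  · rw [sup_sub]; congr 1 <;> abel

theorem Rel.proj (x : Fin m → X) (k : Fin m) : Rel x (H.proj k) (x k) :=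
  ⟨H.proj k, 0, x k, 0, by simpa using Cvx.proj x k 1, Cvx.zero x, by simp, by simp⟩

theorem Rel.zero (x : Fin m → X) : Rel x 0 0 := ⟨0, 0, 0, 0, Cvx.zero x, Cvx.zero x, by simp, by simp⟩


theorem H.neg_one_smul' {m : ℕ} (h : H m) : (-1 : ℝ) • h = -h :=
  H.ext' fun t => by rw [H.smul_apply, neg_one_mul]; rfl

theorem Rel.neg {x : Fin m → X} {h : H m} {y : X} (hh : Rel x h y) : Rel x (-h) (-y) := by
  have := hh.smul (-1)
  rwa [H.neg_one_smul', neg_one_smul] at this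

theorem Rel.sub {x : Fin m → X} {h k : H m} {y z : X} (hh : Rel x h y) (hk : Rel x k z) :
    Rel x (h - k) (y - z) := by
  simpa [sub_eq_add_neg] using hh.add hk.neg

/-- The function `t ↦ ∑ |t_i|`. -/
def H.sumAbs (m : ℕ) : H m := ∑ i, (H.proj i ⊔ -H.proj i)

theorem H.sumAbs_apply (t : Fin m → ℝ) : H.sumAbs m t = ∑ i, |t i| := by
  have h : ∀ s : Finset (Fin m), (∑ i ∈ s, (H.proj i ⊔ -H.proj i) : H m) t = ∑ i ∈ s, |t i| := by
    intro s
    induction s using Finset.induction_on with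
    | empty => rfl
    | insert a s ha ih =>
      rw [Finset.sum_insert ha, Finset.sum_insert ha, H.add_apply, ih]; rfl
  exact h Finset.univ

theorem Rel.sumAbs (x : Fin m → X) : Rel x (H.sumAbs m) (∑ i, |x i|) := by
  have h : ∀ s : Finset (Fin m),
      Rel x (∑ i ∈ s, (H.proj i ⊔ -H.proj i)) (∑ i ∈ s, |x i|) := by
    intro s
    induction s using Finset.induction_on with
    | empty => simpa using Rel.zero x
    | insert a s ha ih =>
      rw [Finset.sum_insert ha, Finset.sum_insert ha]
      exact ((Rel.proj x a).sup (Rel.proj x a).neg).add ih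
  exact h Finset.univ

theorem Rel.dense (x : Fin m → X) (h : H m) {ε : ℝ} (hε : 0 < ε) :
    ∃ k z, Rel x k z ∧ ∀ t, |h t - k t| ≤ ε * ∑ i, |t i| := by
  set K : Set (Fin m → ℝ) := {t | ∑ i, |t i| = 1} with hK
  have hKc : IsCompact K := by
    refine Metric.isCompact_of_isClosed_isBounded ?_ ?_
    · exact isClosed_eq (by fun_prop) continuous_const
    · refine (Metric.isBounded_closedBall (x := (0 : Fin m → ℝ)) (r := 1)).subset fun t ht => ?_
      rw [mem_closedBall_zero_iff, pi_norm_le_iff_of_nonneg zero_le_one]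
      intro i
      rw [Real.norm_eq_abs, ← (show ∑ i, |t i| = 1 from ht)]
      exact Finset.single_le_sum (f := fun i => |t i|) (fun _ _ => abs_nonneg _) (Finset.mem_univ i)
  have : CompactSpace K := isCompact_iff_compactSpace.1 hKc
  let res : H m → C(K, ℝ) := fun k => k.1.restrict K
  set L : Set C(K, ℝ) := res '' {k | ∃ z, Rel x k z} with hL
  have hL_sup : ∀ᵉ (f ∈ L) (g ∈ L), f ⊔ g ∈ L := by
    rintro _ ⟨f, ⟨y, hf⟩, rfl⟩ _ ⟨g, ⟨z, hg⟩, rfl⟩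
    exact ⟨f ⊔ g, ⟨_, hf.sup hg⟩, rfl⟩
  have hL_inf : ∀ᵉ (f ∈ L) (g ∈ L), f ⊓ g ∈ L := by
    rintro _ ⟨f, ⟨y, hf⟩, rfl⟩ _ ⟨g, ⟨z, hg⟩, rfl⟩
    refine ⟨-(-f ⊔ -g), ⟨_, (hf.neg.sup hg.neg).neg⟩, ?_⟩
    ext t
    change -(max (-(f t.1)) (-(g t.1))) = min (f t.1) (g t.1)
    rw [max_neg_neg, neg_neg]
  have hsep : L.SeparatesPointsStrongly := by
    intro v s t
    by_cases hst : s = t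
    · subst hst
      refine ⟨_, ⟨v s • H.sumAbs m, ⟨_, (Rel.sumAbs x).smul _⟩, rfl⟩, ?_, ?_⟩ <;>
      · change v s * H.sumAbs m s.1 = v s
        rw [H.sumAbs_apply, show ∑ i, |s.1 i| = 1 from s.2, mul_one]
    · obtain ⟨i, hi⟩ : ∃ i, s.1 i ≠ t.1 i := by
        by_contra! hcon
        exact hst (Subtype.ext (funext hcon))
      have hi' : s.1 i - t.1 i ≠ 0 := sub_ne_zero.2 hi
      set a : ℝ := (v s - v t) / (s.1 i - t.1 i)
      refine ⟨_, ⟨a • H.proj i + (v s - a * s.1 i) • H.sumAbs m,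
        ⟨_, ((Rel.proj x i).smul _).add ((Rel.sumAbs x).smul _)⟩, rfl⟩, ?_, ?_⟩
      · change a * s.1 i + (v s - a * s.1 i) * H.sumAbs m s.1 = v s
        rw [H.sumAbs_apply, show ∑ i, |s.1 i| = 1 from s.2]; ring
      · change a * t.1 i + (v s - a * s.1 i) * H.sumAbs m t.1 = v t
        rw [H.sumAbs_apply, show ∑ i, |t.1 i| = 1 from t.2]
        have : a * (s.1 i - t.1 i) = v s - v t := div_mul_cancel₀ _ hi'
        linarith
  have htop := ContinuousMap.sublattice_closure_eq_top L ⟨_, ⟨0, ⟨0, Rel.zero x⟩, rfl⟩⟩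
    hL_inf hL_sup hsep
  have hmem : res h ∈ closure L := by rw [htop]; trivial
  obtain ⟨_, ⟨k, ⟨z, hk⟩, rfl⟩, hd⟩ := Metric.mem_closure_iff.1 hmem ε hε
  refine ⟨k, z, hk, fun t => ?_⟩
  set r : ℝ := ∑ i, |t i| with hr
  have hr0 : 0 ≤ r := Finset.sum_nonneg fun _ _ => abs_nonneg _
  rcases hr0.eq_or_lt with h0 | hpos
  · have ht : t = (0 : ℝ) • t := by
      ext i
      have := (Finset.sum_eq_zero_iff_of_nonneg (fun i _ => abs_nonneg (t i))).1 h0.symm i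
        (Finset.mem_univ i)
      simpa using this
    rw [ht, H.map_smul h le_rfl, H.map_smul k le_rfl, ← h0]
    simp
  · have hs : r⁻¹ • t ∈ K := by
      change ∑ i, |(r⁻¹ • t) i| = 1
      simp only [Pi.smul_apply, smul_eq_mul, abs_mul, ← Finset.mul_sum, ← hr]
      rw [abs_of_pos (inv_pos.2 hpos), inv_mul_cancel₀ hpos.ne']
    have ht : t = r • (r⁻¹ • t) := by rw [smul_inv_smul₀ hpos.ne']
    have h1 : |h (r⁻¹ • t) - k (r⁻¹ • t)| ≤ ε := by
      have := (ContinuousMap.dist_apply_le_dist (f := res h) (g := res k) ⟨_, hs⟩).trans hd.le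
      exact this
    rw [ht, H.map_smul h hr0, H.map_smul k hr0, ← mul_sub, abs_mul, abs_of_pos hpos, mul_comm]
    exact mul_le_mul_of_nonneg_right h1 hr0

/-- `Approx x h y`: the pair `(h, y)` is a uniform limit of pairs related by `Rel x`. -/
def Approx (x : Fin m → X) (h : H m) (y : X) : Prop :=
  ∀ ε : ℝ, 0 < ε → ∃ k z, Rel x k z ∧ (∀ t, |h t - k t| ≤ ε * ∑ i, |t i|) ∧
    |y - z| ≤ ε • ∑ i, |x i|

theorem eq_le_of_forall_smul {a b e : X} (h : ∀ ε : ℝ, 0 < ε → a ≤ b + ε • e) : a ≤ b := by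
  have ht : Filter.Tendsto (fun ε : ℝ => b + ε • e) (nhdsWithin 0 (Set.Ioi 0)) (nhds (b + (0 : ℝ) • e)) :=
    (Continuous.tendsto (by fun_prop) 0).mono_left nhdsWithin_le_nhds
  rw [zero_smul, add_zero] at ht
  have : OrderClosedTopology X := inferInstance
  exact ge_of_tendsto ht (by filter_upwards [self_mem_nhdsWithin] with ε hε using h ε hε)

theorem Rel.le_add {x : Fin m → X} {h k : H m} {y z : X} (hh : Rel x h y) (hk : Rel x k z)
    {ε : ℝ} (hle : ∀ t, h t ≤ k t + ε * ∑ i, |t i|) : y ≤ z + ε • ∑ i, |x i| := by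
  refine hh.mono (hk.add ((Rel.sumAbs x).smul ε)) fun t => ?_
  rw [H.add_apply, H.smul_apply, H.sumAbs_apply]; exact hle t

theorem Approx.mono {x : Fin m → X} {h k : H m} {y z : X} (hh : Approx x h y)
    (hk : Approx x k z) (hle : ∀ t, h t ≤ k t) : y ≤ z := by
  refine eq_le_of_forall_smul (e := (4 : ℝ) • ∑ i, |x i|) fun ε hε => ?_
  obtain ⟨h', y', hr, ha, hy⟩ := hh ε hε
  obtain ⟨k', z', hr', ha', hz⟩ := hk ε hε
  have h1 : y' ≤ z' + (2 * ε) • ∑ i, |x i| := hr.le_add hr' fun t => by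
    have h1 := abs_le.1 (ha t)
    have h2 := abs_le.1 (ha' t)
    linarith [hle t]
  have h2 : y ≤ y' + ε • ∑ i, |x i| := by
    have := (le_abs_self _).trans hy
    rwa [sub_le_iff_le_add'] at this
  have h3 : z' ≤ z + ε • ∑ i, |x i| := by
    have := (neg_le_abs _).trans hz
    rwa [neg_sub, sub_le_iff_le_add'] at this
  calc y ≤ y' + ε • ∑ i, |x i| := h2
    _ ≤ (z' + (2 * ε) • ∑ i, |x i|) + ε • ∑ i, |x i| := by gcongr
    _ ≤ ((z + ε • ∑ i, |x i|) + (2 * ε) • ∑ i, |x i|) + ε • ∑ i, |x i| := by gcongr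
    _ = z + ε • (4 : ℝ) • ∑ i, |x i| := by module

theorem Approx.unique {x : Fin m → X} {h : H m} {y z : X} (hy : Approx x h y)
    (hz : Approx x h z) : y = z :=
  le_antisymm (hy.mono hz fun _ => le_rfl) (hz.mono hy fun _ => le_rfl)

theorem Rel.approx {x : Fin m → X} {h : H m} {y : X} (hh : Rel x h y) : Approx x h y := by
  intro ε hε
  refine ⟨h, y, hh, fun t => ?_, ?_⟩
  · rw [sub_self, abs_zero]
    exact mul_nonneg hε.le (Finset.sum_nonneg fun _ _ => abs_nonneg _)
  · rw [sub_self, abs_zero]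
    exact smul_nonneg hε.le (Finset.sum_nonneg fun _ _ => abs_nonneg _)

theorem Approx.add {x : Fin m → X} {h k : H m} {y z : X} (hh : Approx x h y)
    (hk : Approx x k z) : Approx x (h + k) (y + z) := by
  intro ε hε
  obtain ⟨h', y', hr, ha, hy⟩ := hh (ε / 2) (half_pos hε)
  obtain ⟨k', z', hr', ha', hz⟩ := hk (ε / 2) (half_pos hε)
  refine ⟨h' + k', y' + z', hr.add hr', fun t => ?_, ?_⟩
  · rw [H.add_apply, H.add_apply, add_sub_add_comm]
    refine (abs_add_le _ _).trans ((add_le_add (ha t) (ha' t)).trans (le_of_eq ?_)); ring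
  · rw [add_sub_add_comm]
    refine (abs_add_le _ _).trans ((add_le_add hy hz).trans (le_of_eq ?_)); module

theorem Approx.smul {x : Fin m → X} {h : H m} {y : X} (c : ℝ) (hh : Approx x h y) :
    Approx x (c • h) (c • y) := by
  intro ε hε
  have hc : 0 < |c| + 1 := by positivity
  obtain ⟨h', y', hr, ha, hy⟩ := hh (ε / (|c| + 1)) (div_pos hε hc)
  have hle : |c| * (ε / (|c| + 1)) ≤ ε := by
    rw [mul_div_assoc', div_le_iff₀ hc]; nlinarith
  have habs : ∀ w : X, |c • w| = |c| • |w| := by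
    intro w
    have hs : ∀ d : ℝ, 0 ≤ d → d • |w| = |d • w| := by
      intro d hd
      rcases hd.eq_or_lt with rfl | hd
      · simp
      · change d • (w ⊔ -w) = (d • w) ⊔ -(d • w)
        rw [← smul_neg]
        exact (OrderIso.smulRight hd).map_sup w (-w)
    rcases le_total 0 c with h0 | h0
    · rw [abs_of_nonneg h0, hs c h0]
    · rw [abs_of_nonpos h0, hs (-c) (neg_nonneg.2 h0), neg_smul, abs_neg]
  refine ⟨c • h', c • y', hr.smul c, fun t => ?_, ?_⟩
  · rw [H.smul_apply, H.smul_apply, ← mul_sub, abs_mul]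
    refine (mul_le_mul_of_nonneg_left (ha t) (abs_nonneg c)).trans ?_
    rw [← mul_assoc]
    exact mul_le_mul_of_nonneg_right hle (Finset.sum_nonneg fun _ _ => abs_nonneg _)
  · rw [← smul_sub, habs]
    refine (smul_le_smul_of_nonneg_left hy (abs_nonneg c)).trans ?_
    rw [smul_smul]
    exact smul_le_smul_of_nonneg_right hle (Finset.sum_nonneg fun _ _ => abs_nonneg _)

theorem Approx.sup {x : Fin m → X} {h k : H m} {y z : X} (hh : Approx x h y)
    (hk : Approx x k z) : Approx x (h ⊔ k) (y ⊔ z) := by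
  intro ε hε
  obtain ⟨h', y', hr, ha, hy⟩ := hh ε hε
  obtain ⟨k', z', hr', ha', hz⟩ := hk ε hε
  refine ⟨h' ⊔ k', y' ⊔ z', hr.sup hr', fun t => ?_, ?_⟩
  · rw [H.sup_apply, H.sup_apply]
    exact (abs_max_sub_max_le_max _ _ _ _).trans (max_le (ha t) (ha' t))
  · have key : ∀ a b a' b' e : X, |a - a'| ≤ e → |b - b'| ≤ e → (a ⊔ b) - (a' ⊔ b') ≤ e := by
      intro a b a' b' e h1 h2
      rw [sub_le_iff_le_add']
      refine sup_le ?_ ?_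
      · have := (le_abs_self _).trans h1
        rw [sub_le_iff_le_add'] at this
        exact this.trans (by gcongr; exact le_sup_left)
      · have := (le_abs_self _).trans h2
        rw [sub_le_iff_le_add'] at this
        exact this.trans (by gcongr; exact le_sup_right)
    refine abs_le'.2 ⟨key _ _ _ _ _ hy hz, ?_⟩
    rw [neg_sub]
    exact key _ _ _ _ _ (by rwa [abs_sub_comm]) (by rwa [abs_sub_comm])

theorem Approx.exists (x : Fin m → X) (h : H m) : ∃ y, Approx x h y := by
  set e : X := ∑ i, |x i| with he
  have hε : ∀ n : ℕ, (0 : ℝ) < (1 / 2) ^ n := fun n => by positivity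
  choose k z hk hkz using fun n : ℕ => Rel.dense x h (hε n)
  have hle : ∀ n p, n ≤ p → |z p - z n| ≤ (2 * (1 / 2 : ℝ) ^ n) • e := by
    intro n p hnp
    have hpow : (1 / 2 : ℝ) ^ p ≤ (1 / 2) ^ n :=
      pow_le_pow_of_le_one (by norm_num) (by norm_num) hnp
    have haux : ∀ t : Fin m → ℝ, (1 / 2 : ℝ) ^ p * ∑ i, |t i| ≤ (1 / 2) ^ n * ∑ i : Fin m, |t i| := fun t =>
      mul_le_mul_of_nonneg_right hpow (Finset.sum_nonneg fun _ _ => abs_nonneg _)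
    refine abs_le'.2 ⟨?_, ?_⟩
    · rw [sub_le_iff_le_add']
      refine (hk p).le_add (hk n) fun t => ?_
      have h1 := abs_le.1 (hkz p t)
      have h2 := abs_le.1 (hkz n t)
      linarith [haux t]
    · rw [neg_sub, sub_le_iff_le_add']
      refine (hk n).le_add (hk p) fun t => ?_
      have h1 := abs_le.1 (hkz p t)
      have h2 := abs_le.1 (hkz n t)
      linarith [haux t]
  have he0 : 0 ≤ e := Finset.sum_nonneg fun _ _ => abs_nonneg _
  have hcau : CauchySeq z := by
    refine cauchySeq_of_le_geometric (1 / 2) (2 * ‖e‖) (by norm_num) fun n => ?_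
    rw [dist_comm, dist_eq_norm]
    have h1 : ‖z (n + 1) - z n‖ ≤ ‖(2 * (1 / 2 : ℝ) ^ n) • e‖ := by
      refine norm_le_norm_of_abs_le_abs ((hle n (n + 1) n.le_succ).trans (le_abs_self _))
    rw [norm_smul, Real.norm_of_nonneg (by positivity)] at h1
    linarith
  obtain ⟨y, hy⟩ := cauchySeq_tendsto_of_complete hcau
  refine ⟨y, fun ε hε' => ?_⟩
  obtain ⟨n, hn⟩ := exists_pow_lt_of_lt_one (half_pos hε') (by norm_num : (1 / 2 : ℝ) < 1)
  refine ⟨k n, z n, hk n, fun t => (hkz n t).trans ?_, ?_⟩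
  · exact mul_le_mul_of_nonneg_right (by linarith) (Finset.sum_nonneg fun _ _ => abs_nonneg _)
  · have h1 : |y - z n| ≤ (2 * (1 / 2 : ℝ) ^ n) • e := by
      have hev : ∀ᶠ p in Filter.atTop, |z p - z n| ≤ (2 * (1 / 2 : ℝ) ^ n) • e :=
        Filter.eventually_atTop.2 ⟨n, fun p hp => hle n p hp⟩
      refine abs_le'.2 ⟨?_, ?_⟩
      · exact le_of_tendsto (hy.sub_const (z n)) (hev.mono fun p hp => (le_abs_self _).trans hp)
      · exact le_of_tendsto (hy.sub_const (z n)).neg (hev.mono fun p hp => (neg_le_abs _).trans hp)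
    exact h1.trans (smul_le_smul_of_nonneg_right (by linarith) he0)

/-- Every Banach lattice admits a positively homogeneous continuous function calculus. -/
theorem nonempty_functionCalculus (X : Type*) [NormedAddCommGroup X] [NormedSpace ℝ X] [Lattice X]
    [BanachLattice X] : Nonempty (FunctionCalculus X) := by
  choose Φ hΦ using fun (m : ℕ) (x : Fin m → X) (h : H m) => Approx.exists x h
  refine ⟨{ Φ := fun {m} x =>
              { toFun := Φ m x
                map_add' := fun h k => (hΦ m x _).unique ((hΦ m x h).add (hΦ m x k))
                map_smul' := fun c h => (hΦ m x _).unique ((hΦ m x h).smul c) }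
            isLatticeHom := fun {m} x => ?_
            map_proj := fun {m} x k => (hΦ m x _).unique (Rel.proj x k).approx }⟩
  have hneg : ∀ h, Φ m x (-h) = -Φ m x h := fun h =>
    (hΦ m x _).unique (by
      have := (hΦ m x h).smul (-1)
      rwa [H.neg_one_smul', neg_one_smul] at this)
  have hsup : ∀ h k, Φ m x (h ⊔ k) = Φ m x h ⊔ Φ m x k := fun h k =>
    (hΦ m x _).unique ((hΦ m x h).sup (hΦ m x k))
  refine ⟨hsup, fun h k => ?_⟩
  change Φ m x (h ⊓ k) = Φ m x h ⊓ Φ m x k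
  have h1 : h ⊓ k = -(-h ⊔ -k) := by
    refine H.ext' fun t => ?_
    change min (h t) (k t) = -(max (-(h t)) (-(k t)))
    rw [max_neg_neg, neg_neg]
  rw [h1, hneg, hsup, hneg, hneg, neg_sup, neg_neg, neg_neg]

end Existence

/-- The positively homogeneous continuous function calculus of a Banach lattice (it is unique). -/
def functionCalculus (X : Type*) [NormedAddCommGroup X] [NormedSpace ℝ X] [Lattice X]
    [BanachLattice X] : FunctionCalculus X :=
  (nonempty_functionCalculus X).some

/-! ### Convexity conditions -/

/-- `h` is monotone on the positive cone of `ℝ^m`. -/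
def H.MonotoneOnCone {m : ℕ} (h : H m) : Prop :=
  ∀ s t : Fin m → ℝ, 0 ≤ s → s ≤ t → h s ≤ h t

/-- A convexity condition `D = (G, M, ϑ)`: a nonempty set `G` of continuous, positively homogeneous
functions of finitely many (at least one) variables which are monotone on the positive cone, and
functions `M : G → [1, ∞)` and `ϑ : G → {0, 1}`. -/
structure ConvexityCondition where
  /-- The set of functions, each together with its number of variables. -/
  G : Set (Σ m : ℕ, H m)
  nonempty : G.Nonempty
  pos : ∀ g ∈ G, 1 ≤ g.1
  monotone : ∀ g ∈ G, H.MonotoneOnCone g.2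
  /-- The constants. -/
  M : G → ℝ
  one_le_M : ∀ g, 1 ≤ M g
  /-- `ϑ g = 0` means that only pairwise disjoint tuples are tested. -/
  ϑ : G → Fin 2

/-- A seminorm `ν` on a vector lattice is a lattice seminorm if `|x| ≤ |y|` implies
`ν x ≤ ν y`. -/
def IsLatticeSeminorm {X : Type*} [AddCommGroup X] [Module ℝ X] [Lattice X]
    (ν : Seminorm ℝ X) : Prop :=
  ∀ x y : X, |x| ≤ |y| → ν x ≤ ν y

/-- `D`-convexity of a (lattice) seminorm `ν` on a vector lattice `X` with a positively homogeneous
continuous function calculus `Φ`: the inequality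
`ν (g(x_1, …, x_m)) ≤ M(g) g(ν x_1, …, ν x_m)` for all `g ∈ G` and all positive `x_1, …, x_m`,
which are assumed to be pairwise disjoint in case `ϑ(g) = 0`. -/
def IsDConvexSeminorm (D : ConvexityCondition) {X : Type*} [AddCommGroup X] [Module ℝ X]
    [Lattice X] (Φ : FunctionCalculus X) (ν : Seminorm ℝ X) : Prop :=
  ∀ (m : ℕ) (g : H m) (hg : (⟨m, g⟩ : Σ m : ℕ, H m) ∈ D.G) (x : Fin m → X),
    (∀ i, 0 ≤ x i) →
    (D.ϑ ⟨_, hg⟩ = 0 → ∀ i j, i ≠ j → |x i| ⊓ |x j| = 0) →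
    ν (Φ.Φ x g) ≤ D.M ⟨_, hg⟩ * g (fun i => ν (x i))

/-- A Banach lattice is `D`-convex if its norm is `D`-convex. -/
def IsDConvex (D : ConvexityCondition) (X : Type*) [NormedAddCommGroup X] [NormedSpace ℝ X]
    [Lattice X] [BanachLattice X] : Prop :=
  IsDConvexSeminorm D (functionCalculus X) (normSeminorm ℝ X)

/-! ### The vector lattice from which the free `D`-convex Banach lattice is built -/

section Free

variable (E : Type*) [NormedAddCommGroup E] [NormedSpace ℝ E]

/-- The closed unit ball of the dual space of `E`. -/
abbrev DualBall : Type _ := Metric.closedBall (0 : StrongDual ℝ E) 1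

variable {E}

/-- `f` is of the form `h(δ_{x_1}, …, δ_{x_m})`, where `δ_x` is the evaluation `φ ↦ φ x`. -/
def IsGen (f : DualBall E → ℝ) : Prop :=
  ∃ (m : ℕ) (h : H m) (x : Fin m → E), ∀ φ : DualBall E, f φ = h (fun i => φ.1 (x i))

theorem IsGen.calculus {n : ℕ} (h : H n) {f : Fin n → DualBall E → ℝ} (hf : ∀ i, IsGen (f i)) :
    IsGen (fun φ => h (fun i => f i φ)) := by
  choose m g x hg using hf
  refine ⟨∑ i, m i, ⟨⟨fun t => h (fun i => g i (fun j => t (finSigmaFinEquiv ⟨i, j⟩))), ?_⟩, ?_⟩,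
    fun k => x (finSigmaFinEquiv.symm k).1 (finSigmaFinEquiv.symm k).2, fun φ => ?_⟩
  · exact h.1.continuous.comp (continuous_pi fun i => (g i).1.continuous.comp
      (continuous_pi fun j => continuous_apply _))
  · intro r hr t
    change h (fun i => g i (r • (fun j => t (finSigmaFinEquiv ⟨i, j⟩)))) = r * h _
    rw [← H.map_smul h hr]
    congr 1
    ext i
    exact H.map_smul (g i) hr _
  · change _ = h (fun i => g i (fun j => φ.1 (x (finSigmaFinEquiv.symm (finSigmaFinEquiv ⟨i, j⟩)).1
      (finSigmaFinEquiv.symm (finSigmaFinEquiv ⟨i, j⟩)).2)))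
    refine congrArg h.1 (funext fun i => ?_)
    rw [hg]
    refine congrArg (g i).1 (funext fun j => ?_)
    rw [Equiv.symm_apply_apply]

theorem IsGen.add {f g : DualBall E → ℝ} (hf : IsGen f) (hg : IsGen g) : IsGen (f + g) :=
  IsGen.calculus (f := ![f, g]) (H.proj 0 + H.proj 1) (Fin.forall_fin_two.2 ⟨hf, hg⟩)

theorem IsGen.sup {f g : DualBall E → ℝ} (hf : IsGen f) (hg : IsGen g) : IsGen (f ⊔ g) :=
  IsGen.calculus (f := ![f, g]) (H.proj 0 ⊔ H.proj 1) (Fin.forall_fin_two.2 ⟨hf, hg⟩)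

theorem IsGen.inf {f g : DualBall E → ℝ} (hf : IsGen f) (hg : IsGen g) : IsGen (f ⊓ g) :=
  IsGen.calculus (f := ![f, g]) (H.proj 0 ⊓ H.proj 1) (Fin.forall_fin_two.2 ⟨hf, hg⟩)

theorem IsGen.smul (c : ℝ) {f : DualBall E → ℝ} (hf : IsGen f) : IsGen (c • f) :=
  IsGen.calculus (f := ![f]) (c • H.proj 0) (fun i => by fin_cases i; exact hf)

theorem IsGen.zero : IsGen (0 : DualBall E → ℝ) := ⟨0, 0, ![], fun _ => rfl⟩

variable (E)

/-- The vector lattice of all functions `h(δ_{x_1}, …, δ_{x_m})` on the dual unit ball, where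
`h ∈ H m` and `x_1, …, x_m ∈ E`. -/
def Y0 : Submodule ℝ (DualBall E → ℝ) where
  carrier := {f | IsGen f}
  zero_mem' := IsGen.zero
  add_mem' := IsGen.add
  smul_mem' := fun c _ hf => IsGen.smul c hf

/-- The order of `Y0 E` is the pointwise order. -/
instance : Lattice (Y0 E) := Subtype.lattice (fun _ _ => IsGen.sup) (fun _ _ => IsGen.inf)

variable {E}

theorem Y0.sup_apply (f g : Y0 E) (φ : DualBall E) : (f ⊔ g).1 φ = f.1 φ ⊔ g.1 φ := rfl
theorem Y0.abs_apply (f : Y0 E) (φ : DualBall E) : (|f|).1 φ = |f.1 φ| := rfl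

instance : IsOrderedAddMonoid (Y0 E) where
  add_le_add_left _ _ h k φ := add_le_add_left (h φ) (k.1 φ)

instance : IsOrderedModule ℝ (Y0 E) where
  smul_le_smul_of_nonneg_left _ hc _ _ h φ := mul_le_mul_of_nonneg_left (h φ) hc
  smul_le_smul_of_nonneg_right _ hf _ _ h φ := mul_le_mul_of_nonneg_right h (hf φ)

/-- The evaluation `δ_x : φ ↦ φ x`, as an element of `Y0 E`. -/
def δ (x : E) : Y0 E := ⟨fun φ => φ.1 x, 1, H.proj 0, ![x], fun _ => rfl⟩

variable (E)

/-- The function calculus of `Y0 E` is given pointwise. -/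
def Y0.functionCalculus : FunctionCalculus (Y0 E) where
  Φ f :=
    { toFun := fun h => ⟨fun φ => h (fun i => (f i).1 φ), IsGen.calculus h fun i => (f i).2⟩
      map_add' := fun _ _ => rfl
      map_smul' := fun _ _ => rfl }
  isLatticeHom _ := ⟨fun _ _ => rfl, fun _ _ => rfl⟩
  map_proj _ _ := rfl

variable (D : ConvexityCondition)

/-- The `D`-convex lattice seminorms `ν` on `Y0 E` such that `ν (δ_x) ≤ ‖x‖` for all `x`. -/
def admissible : Set (Seminorm ℝ (Y0 E)) :=
  {ν | IsLatticeSeminorm ν ∧ IsDConvexSeminorm D (Y0.functionCalculus E) ν ∧ ∀ x, ν (δ x) ≤ ‖x‖}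

variable {E}

/-- The largest `D`-convex lattice seminorm on `Y0 E` such that `‖δ_x‖ ≤ ‖x‖` for all `x`. -/
def normD (f : Y0 E) : ℝ := sSup ((fun ν : Seminorm ℝ (Y0 E) => ν f) '' admissible E D)

theorem admissible_nonempty : (admissible E D).Nonempty := by
  refine ⟨0, fun _ _ _ => le_rfl, fun m g hg x hx _ => ?_, fun x => by simp⟩
  change 0 ≤ D.M ⟨_, hg⟩ * g 0
  have : g 0 = 0 := by simpa using H.map_smul g le_rfl 0
  rw [this, mul_zero]

theorem H.bound {m : ℕ} (h : H m) : ∃ C : ℝ, 0 ≤ C ∧ ∀ t, |h t| ≤ C * ∑ i, |t i| := by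
  obtain ⟨C, hC⟩ := (isCompact_sphere (0 : Fin m → ℝ) 1).exists_bound_of_continuousOn
    h.1.continuous.continuousOn
  refine ⟨max C 0, le_max_right _ _, fun t => ?_⟩
  have hsum : ‖t‖ ≤ ∑ i, |t i| := by
    rw [pi_norm_le_iff_of_nonneg (Finset.sum_nonneg fun _ _ => abs_nonneg _)]
    exact fun i => Finset.single_le_sum (f := fun i => |t i|) (fun _ _ => abs_nonneg _)
      (Finset.mem_univ i)
  refine le_trans ?_ (mul_le_mul_of_nonneg_left hsum (le_max_right _ _))
  rcases eq_or_ne t 0 with rfl | ht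
  · have : h 0 = 0 := by simpa using H.map_smul h le_rfl 0
    simp [this]
  · have hpos : 0 < ‖t‖ := norm_pos_iff.2 ht
    have h1 : t = ‖t‖ • (‖t‖⁻¹ • t) := by rw [smul_inv_smul₀ hpos.ne']
    have h2 := hC (‖t‖⁻¹ • t) (by
      rw [mem_sphere_zero_iff_norm, norm_smul, norm_inv, norm_norm, inv_mul_cancel₀ hpos.ne'])
    have h3 : h t = ‖t‖ * h (‖t‖⁻¹ • t) := by
      conv_lhs => rw [h1]
      exact H.map_smul h hpos.le _
    rw [h3, abs_mul, abs_of_pos hpos, mul_comm]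
    exact mul_le_mul_of_nonneg_right (h2.trans (le_max_left _ _)) hpos.le

theorem bddAbove_admissible (f : Y0 E) :
    BddAbove ((fun ν : Seminorm ℝ (Y0 E) => ν f) '' admissible E D) := by
  obtain ⟨m, h, x, hf⟩ := f.2
  obtain ⟨C, hC0, hC⟩ := H.bound h
  refine ⟨C * ∑ i, ‖x i‖, ?_⟩
  rintro _ ⟨ν, ⟨hν, -, hx⟩, rfl⟩
  have hsum : ∀ (s : Finset (Fin m)) (φ : DualBall E),
      (∑ i ∈ s, |δ (x i)| : Y0 E).1 φ = ∑ i ∈ s, |φ.1 (x i)| := by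
    intro s φ
    induction s using Finset.induction_on with
    | empty => rfl
    | insert a s ha ih => rw [Finset.sum_insert ha, Finset.sum_insert ha, ← ih]; rfl
  have h1 : ν f ≤ ν (C • ∑ i, |δ (x i)|) := by
    refine hν _ _ (le_trans ?_ (le_abs_self _))
    intro φ
    change |f.1 φ| ≤ C * (∑ i, |δ (x i)| : Y0 E).1 φ
    rw [hf, hsum]
    exact hC _
  have h2 : ∀ s : Finset (Fin m), ν (∑ i ∈ s, |δ (x i)|) ≤ ∑ i ∈ s, ‖x i‖ := by
    intro s
    induction s using Finset.induction_on with
    | empty => simp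
    | insert a s ha ih =>
      rw [Finset.sum_insert ha, Finset.sum_insert ha]
      refine (map_add_le_add ν _ _).trans (add_le_add ?_ ih)
      exact (hν _ _ (abs_abs _).le).trans (hx (x a))
  refine h1.trans ?_
  rw [map_smul_eq_mul, Real.norm_of_nonneg hC0]
  exact mul_le_mul_of_nonneg_left (h2 _) hC0

/-- Evaluation at a point of the dual unit ball is an admissible seminorm. -/
def evalSeminorm (φ : DualBall E) : Seminorm ℝ (Y0 E) :=
  Seminorm.of (fun f => |f.1 φ|) (fun f g => abs_add_le (f.1 φ) (g.1 φ))
    (fun c f => by change |c * f.1 φ| = _; rw [abs_mul]; rfl)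

theorem evalSeminorm_mem (φ : DualBall E) : evalSeminorm φ ∈ admissible E D := by
  refine ⟨fun f g h => h φ, fun m g hg f hf _ => ?_, fun x => ?_⟩
  · change |g (fun i => (f i).1 φ)| ≤ D.M ⟨_, hg⟩ * g (fun i => |(f i).1 φ|)
    have h1 : ∀ i, |(f i).1 φ| = (f i).1 φ := fun i => abs_of_nonneg (hf i φ)
    simp only [h1]
    have h0 : g 0 = 0 := by simpa using H.map_smul g le_rfl 0
    have h2 : 0 ≤ g (fun i => (f i).1 φ) := by
      rw [← h0]
      exact D.monotone _ hg 0 _ le_rfl fun i => hf i φ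
    rw [abs_of_nonneg h2]
    exact le_mul_of_one_le_left h2 (D.one_le_M _)
  · refine (φ.1.le_opNorm x).trans ?_
    exact mul_le_of_le_one_left (norm_nonneg _) (mem_closedBall_zero_iff.1 φ.2)

theorem le_normD {ν : Seminorm ℝ (Y0 E)} (hν : ν ∈ admissible E D) (f : Y0 E) : ν f ≤ normD D f :=
  le_csSup (bddAbove_admissible D f) ⟨ν, hν, rfl⟩

theorem normD_le {f : Y0 E} {C : ℝ} (h : ∀ ν ∈ admissible E D, ν f ≤ C) : normD D f ≤ C :=
  csSup_le ((admissible_nonempty D).image _) (by rintro _ ⟨ν, hν, rfl⟩; exact h ν hν)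

/-- A copy of `Y0 E`, to be equipped with the norm `normD D`. -/
def PreFree (_D : ConvexityCondition) (E : Type*) [NormedAddCommGroup E] [NormedSpace ℝ E] :
    Type _ := Y0 E

instance : AddCommGroup (PreFree D E) := inferInstanceAs (AddCommGroup (Y0 E))
instance : Module ℝ (PreFree D E) := inferInstanceAs (Module ℝ (Y0 E))
instance : Lattice (PreFree D E) := inferInstanceAs (Lattice (Y0 E))
instance : IsOrderedAddMonoid (PreFree D E) := inferInstanceAs (IsOrderedAddMonoid (Y0 E))
instance : IsOrderedModule ℝ (PreFree D E) := inferInstanceAs (IsOrderedModule ℝ (Y0 E))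
instance : Norm (PreFree D E) := ⟨fun f => normD (E := E) D f⟩

theorem PreFree.core : NormedSpace.Core ℝ (PreFree D E) where
  norm_nonneg f := (apply_nonneg (0 : Seminorm ℝ (Y0 E)) f).trans
    ((apply_nonneg (evalSeminorm (E := E) ⟨0, by simp⟩) f).trans
      (le_normD D (evalSeminorm_mem D _) f))
  norm_smul c f := by
    have hle : ∀ (c : ℝ) (f : Y0 E), normD D (c • f) ≤ ‖c‖ * normD D f := fun c f =>
      normD_le D fun ν hν => by
        rw [map_smul_eq_mul]
        exact mul_le_mul_of_nonneg_left (le_normD D hν f) (norm_nonneg c)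
    refine le_antisymm (hle c f) ?_
    rcases eq_or_ne c 0 with rfl | hc
    · rw [norm_zero, zero_mul]
      exact (apply_nonneg (evalSeminorm (E := E) ⟨0, by simp⟩) _).trans
        (le_normD D (evalSeminorm_mem D _) _)
    · have h1 : normD (E := E) D f ≤ ‖c⁻¹‖ * normD (E := E) D (c • f : Y0 E) := by
        have := hle c⁻¹ (c • f : Y0 E)
        have e : c⁻¹ • (c • f : Y0 E) = (f : Y0 E) := by
          refine Subtype.ext (funext fun φ => ?_)
          change c⁻¹ * (c * f.1 φ) = f.1 φ
          rw [inv_mul_cancel_left₀ hc]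
        exact (congrArg (normD (E := E) D) e).ge.trans this
      rw [norm_inv, ← div_eq_inv_mul, le_div_iff₀ (norm_pos_iff.2 hc)] at h1
      rw [mul_comm]
      exact h1
  norm_triangle f g := normD_le (E := E) D fun ν hν =>
    (map_add_le_add ν f g).trans (add_le_add (le_normD D hν f) (le_normD D hν g))
  norm_eq_zero_iff f := by
    constructor
    · intro h
      refine Subtype.ext (funext fun φ => ?_)
      have h1 : |f.1 φ| ≤ normD (E := E) D f := le_normD D (evalSeminorm_mem D φ) f
      exact abs_nonpos_iff.1 (h1.trans h.le)
    · rintro rfl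
      refine le_antisymm (normD_le (E := E) D fun ν _ => (map_zero ν).le) ?_
      exact (map_zero (evalSeminorm (E := E) ⟨0, by simp⟩)).ge.trans
        (le_normD D (evalSeminorm_mem D _) _)

instance : NormedAddCommGroup (PreFree D E) := NormedAddCommGroup.ofCore (PreFree.core D)
instance : NormedSpace ℝ (PreFree D E) := NormedSpace.ofCore (PreFree.core D)

instance : HasSolidNorm (PreFree D E) where
  solid f g h := normD_le (E := E) D fun _ hν => (hν.1 f g h).trans (le_normD D hν g)


end Free

/-! ### The completion of a normed vector lattice -/

section Completion

open UniformSpace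

variable {X : Type*} [NormedAddCommGroup X] [Lattice X] [HasSolidNorm X] [IsOrderedAddMonoid X]

theorem uniformContinuous₂_sup : UniformContinuous₂ (fun x y : X => x ⊔ y) := by
  refine Metric.uniformContinuous_iff.2 fun ε hε => ⟨ε / 2, half_pos hε, ?_⟩
  rintro ⟨a, b⟩ ⟨c, d⟩ h
  rw [Prod.dist_eq, max_lt_iff, dist_eq_norm, dist_eq_norm] at h
  change dist (a ⊔ b) (c ⊔ d) < ε
  rw [dist_eq_norm]
  refine (norm_sup_sub_sup_le_add_norm a b c d).trans_lt ?_
  linarith [h.1, h.2]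

theorem uniformContinuous₂_inf : UniformContinuous₂ (fun x y : X => x ⊓ y) := by
  refine Metric.uniformContinuous_iff.2 fun ε hε => ⟨ε / 2, half_pos hε, ?_⟩
  rintro ⟨a, b⟩ ⟨c, d⟩ h
  rw [Prod.dist_eq, max_lt_iff, dist_eq_norm, dist_eq_norm] at h
  change dist (a ⊓ b) (c ⊓ d) < ε
  rw [dist_eq_norm]
  refine (norm_inf_sub_inf_le_add_norm a b c d).trans_lt ?_
  linarith [h.1, h.2]

instance : Max (Completion X) := ⟨Completion.map₂ (· ⊔ ·)⟩
instance : Min (Completion X) := ⟨Completion.map₂ (· ⊓ ·)⟩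

theorem coe_sup (x y : X) : ((x ⊔ y : X) : Completion X) = (x : Completion X) ⊔ y :=
  (Completion.map₂_coe_coe x y _ uniformContinuous₂_sup).symm

theorem coe_inf (x y : X) : ((x ⊓ y : X) : Completion X) = (x : Completion X) ⊓ y :=
  (Completion.map₂_coe_coe x y _ uniformContinuous₂_inf).symm

instance : ContinuousSup (Completion X) :=
  ⟨Completion.continuous_map₂ continuous_fst continuous_snd⟩

instance : ContinuousInf (Completion X) :=
  ⟨Completion.continuous_map₂ continuous_fst continuous_snd⟩

/-- The lattice operations of the completion are the continuous extensions of those of `X`. -/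
instance : Lattice (Completion X) :=
  Lattice.mk'
    (fun a b => Completion.induction_on₂ a b (isClosed_eq (by fun_prop) (by fun_prop))
      fun x y => by rw [← coe_sup, ← coe_sup, sup_comm])
    (fun a b c => Completion.induction_on₃ a b c (isClosed_eq (by fun_prop) (by fun_prop))
      fun x y z => by simp only [← coe_sup, sup_assoc])
    (fun a b => Completion.induction_on₂ a b (isClosed_eq (by fun_prop) (by fun_prop))
      fun x y => by rw [← coe_inf, ← coe_inf, inf_comm])
    (fun a b c => Completion.induction_on₃ a b c (isClosed_eq (by fun_prop) (by fun_prop))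
      fun x y z => by simp only [← coe_inf, inf_assoc])
    (fun a b => Completion.induction_on₂ a b (isClosed_eq (by fun_prop) (by fun_prop))
      fun x y => by rw [← coe_inf, ← coe_sup, sup_inf_self])
    (fun a b => Completion.induction_on₂ a b (isClosed_eq (by fun_prop) (by fun_prop))
      fun x y => by rw [← coe_sup, ← coe_inf, inf_sup_self])

theorem add_sup_completion (c a b : Completion X) : c + (a ⊔ b) = (c + a) ⊔ (c + b) :=
  Completion.induction_on₃ a b c (isClosed_eq (by fun_prop) (by fun_prop))
    fun x y z => by
      rw [← coe_sup, ← Completion.coe_add, ← Completion.coe_add, ← Completion.coe_add, ← coe_sup,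
        add_sup]

instance : IsOrderedAddMonoid (Completion X) where
  add_le_add_left a b h c := by
    rw [← sup_eq_right] at h ⊢
    rw [add_comm a, add_comm b, ← add_sup_completion, h]

instance : HasSolidNorm (Completion X) where
  solid a b h := by
    have habs : ∀ a : Completion X, ‖a ⊔ -a‖ = ‖a‖ := fun a =>
      Completion.induction_on a (isClosed_eq (by fun_prop) (by fun_prop)) fun x => by
        rw [← Completion.coe_neg, ← coe_sup, Completion.norm_coe, Completion.norm_coe]
        exact norm_abs_eq_norm x
    have hle : ∀ a b : Completion X, ‖a ⊔ -a‖ ≤ ‖(a ⊔ -a) ⊔ (b ⊔ -b)‖ := fun a b =>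
      Completion.induction_on₂ a b (isClosed_le (by fun_prop) (by fun_prop)) fun x y => by
        simp only [← Completion.coe_neg, ← coe_sup, Completion.norm_coe]
        refine norm_le_norm_of_abs_le_abs ?_
        change |(|x|)| ≤ |(|x| ⊔ |y|)|
        rw [abs_abs]
        exact le_sup_left.trans (le_abs_self _)
    have h1 : (a ⊔ -a) ⊔ (b ⊔ -b) = b ⊔ -b := sup_eq_right.2 h
    have h2 := hle a b
    rwa [h1, habs, habs] at h2

instance [NormedSpace ℝ X] [IsOrderedModule ℝ X] : IsOrderedModule ℝ (Completion X) := by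
  have hpos : ∀ (c : ℝ), 0 ≤ c → ∀ a : Completion X, 0 ≤ a → 0 ≤ c • a := by
    intro c hc a ha
    have key : (0 : Completion X) ⊔ c • (0 ⊔ a) = c • (0 ⊔ a) :=
      Completion.induction_on a (isClosed_eq
        (continuous_const.sup ((continuous_const.sup continuous_id).const_smul c))
        ((continuous_const.sup continuous_id).const_smul c)) fun x => by
        rw [← Completion.coe_zero, ← coe_sup, ← Completion.coe_smul, ← coe_sup]
        congr 1
        exact sup_eq_right.2 (smul_nonneg hc le_sup_left)
    rw [sup_eq_right.2 ha] at key
    exact sup_eq_right.1 key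
  exact
    { smul_le_smul_of_nonneg_left := fun c hc a b h => by
        rw [← sub_nonneg, ← smul_sub]; exact hpos c hc _ (sub_nonneg.2 h)
      smul_le_smul_of_nonneg_right := fun a ha c d h => by
        rw [← sub_nonneg, ← sub_smul]; exact hpos _ (sub_nonneg.2 h) a ha }

instance [NormedSpace ℝ X] [IsOrderedModule ℝ X] : BanachLattice (Completion X) where

end Completion

/-- The free `D`-convex Banach lattice over `E`: the completion of the vector lattice of functions
`h(δ_{x_1}, …, δ_{x_m})` with respect to the largest `D`-convex lattice norm for which
`‖δ_x‖ ≤ ‖x‖`. -/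
abbrev FBL (D : ConvexityCondition) (E : Type*) [NormedAddCommGroup E] [NormedSpace ℝ E] : Type _ :=
  UniformSpace.Completion (PreFree D E)

/-! ### Quotients by closed ideals and projective universality -/

/-- A closed ideal of a Banach lattice: a closed linear subspace which is solid. -/
structure ClosedIdeal (Z : Type*) [NormedAddCommGroup Z] [NormedSpace ℝ Z] [Lattice Z] where
  /-- The underlying linear subspace. -/
  carrier : Submodule ℝ Z
  isClosed : IsClosed (carrier : Set Z)
  solid : ∀ x ∈ carrier, ∀ y, |y| ≤ |x| → y ∈ carrier

namespace ClosedIdeal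

variable {Z : Type*} [NormedAddCommGroup Z] [NormedSpace ℝ Z] [Lattice Z] [BanachLattice Z]
  (J : ClosedIdeal Z)

/-- The quotient `Z / J`. -/
def Quot : Type _ := Z ⧸ J.carrier

/-- `Z / J` carries the quotient norm. -/
instance : NormedAddCommGroup J.Quot :=
  letI : IsClosed (J.carrier : Set Z) := J.isClosed
  inferInstanceAs (NormedAddCommGroup (Z ⧸ J.carrier))

instance : NormedSpace ℝ J.Quot := inferInstanceAs (NormedSpace ℝ (Z ⧸ J.carrier))

/-- The quotient map `Z → Z / J`. -/
def proj : Z →ₗ[ℝ] J.Quot := J.carrier.mkQ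

theorem proj_surjective : Function.Surjective J.proj := J.carrier.mkQ_surjective

theorem sup_sub_mem {a b c d : Z} (h1 : a - c ∈ J.carrier) (h2 : b - d ∈ J.carrier) :
    (a ⊔ b) - (c ⊔ d) ∈ J.carrier := by
  have habs : ∀ x ∈ J.carrier, |x| ∈ J.carrier := fun x hx => J.solid x hx _ (abs_abs x).le
  refine J.solid _ (J.carrier.add_mem (habs _ h1) (habs _ h2)) _ ?_
  refine le_trans ?_ (le_abs_self _)
  calc |(a ⊔ b) - (c ⊔ d)| = |((a ⊔ b) - (c ⊔ b)) + ((c ⊔ b) - (c ⊔ d))| := by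
        rw [sub_add_sub_cancel]
    _ ≤ |(a ⊔ b) - (c ⊔ b)| + |(c ⊔ b) - (c ⊔ d)| := abs_add_le _ _
    _ ≤ |a - c| + |b - d| := by
      refine add_le_add (abs_sup_sub_sup_le_abs _ _ _) ?_
      rw [sup_comm c b, sup_comm c d]
      exact abs_sup_sub_sup_le_abs _ _ _

theorem inf_sub_mem {a b c d : Z} (h1 : a - c ∈ J.carrier) (h2 : b - d ∈ J.carrier) :
    (a ⊓ b) - (c ⊓ d) ∈ J.carrier := by
  have := J.sup_sub_mem (a := -a) (b := -b) (c := -c) (d := -d)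
    (by have := J.carrier.neg_mem h1; rwa [neg_sub_neg, ← neg_sub])
    (by have := J.carrier.neg_mem h2; rwa [neg_sub_neg, ← neg_sub])
  rw [← neg_inf, ← neg_inf, neg_sub_neg, ← neg_sub] at this
  exact J.carrier.neg_mem_iff.1 this

instance : Max J.Quot :=
  ⟨Quotient.map₂ (· ⊔ ·) fun _ _ h1 _ _ h2 =>
    J.carrier.quotientRel_def.2
      (J.sup_sub_mem (J.carrier.quotientRel_def.1 h1) (J.carrier.quotientRel_def.1 h2))⟩

instance : Min J.Quot :=
  ⟨Quotient.map₂ (· ⊓ ·) fun _ _ h1 _ _ h2 =>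
    J.carrier.quotientRel_def.2
      (J.inf_sub_mem (J.carrier.quotientRel_def.1 h1) (J.carrier.quotientRel_def.1 h2))⟩

theorem proj_sup (a b : Z) : J.proj (a ⊔ b) = J.proj a ⊔ J.proj b := rfl
theorem proj_inf (a b : Z) : J.proj (a ⊓ b) = J.proj a ⊓ J.proj b := rfl

/-- The lattice operations of `Z / J` are those for which the quotient map is a lattice
homomorphism. -/
instance : Lattice J.Quot :=
  Lattice.mk'
    (J.proj_surjective.forall₂.2 fun a b => by rw [← proj_sup, ← proj_sup, sup_comm])
    (J.proj_surjective.forall₃.2 fun a b c => by simp only [← proj_sup, sup_assoc])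
    (J.proj_surjective.forall₂.2 fun a b => by rw [← proj_inf, ← proj_inf, inf_comm])
    (J.proj_surjective.forall₃.2 fun a b c => by simp only [← proj_inf, inf_assoc])
    (J.proj_surjective.forall₂.2 fun a b => by rw [← proj_inf, ← proj_sup, sup_inf_self])
    (J.proj_surjective.forall₂.2 fun a b => by rw [← proj_sup, ← proj_inf, inf_sup_self])

end ClosedIdeal

/-- `X` is lattice isometric to a quotient of `Z` by a closed ideal. -/
def IsLatticeIsometricToQuotient (X Z : Type*) [NormedAddCommGroup X] [NormedSpace ℝ X] [Lattice X]
    [BanachLattice X] [NormedAddCommGroup Z] [NormedSpace ℝ Z] [Lattice Z] [BanachLattice Z] :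
    Prop :=
  ∃ (J : ClosedIdeal Z) (U : J.Quot ≃ₗᵢ[ℝ] X), IsLatticeHom U.toLinearEquiv.toLinearMap

/-- `Z` is projectively universal for the class of separable, `D`-convex Banach lattices. -/
def IsProjectivelyUniversal.{u, v} (D : ConvexityCondition) (Z : Type v) [NormedAddCommGroup Z]
    [NormedSpace ℝ Z] [Lattice Z] [BanachLattice Z] : Prop :=
  TopologicalSpace.SeparableSpace Z ∧ IsDConvex D Z ∧
    ∀ (X : Type u) [NormedAddCommGroup X] [NormedSpace ℝ X] [Lattice X] [BanachLattice X],
      TopologicalSpace.SeparableSpace X → IsDConvex D X → IsLatticeIsometricToQuotient X Z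

/-- The Banach space `ℓ_1` of absolutely summable real sequences. -/
abbrev ell1 : Type := lp (fun _ : ℕ => ℝ) 1

end FreeBL

end

universe u

/-! A contraction `T` from a Banach space `E` to a `D`-convex Banach lattice `X` extends to `Y0 E`
by sending `h(δ_{x_1}, …, δ_{x_m})` to `h(T x_1, …, T x_m)`. The extension is a lattice
homomorphism, so the norm of `X` pulls back to an admissible seminorm, and the norm of the free
lattice dominates every such seminorm. Hence `T` extends to a contractive lattice homomorphism on
`FBL D E` (`exists_extension`).

If `X` is separable, there is a contraction `T` from `ℓ_1` to `X` under which each `x` has preimages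
of norm at most `‖x‖ + ε` (`exists_ell1_metric_surjection`). As `a ↦ δ_a` is a contraction, the
extension of `T` has the same property, so it induces a lattice isometry from the quotient by its
kernel onto `X` (`isLatticeIsometricToQuotient_of_metric_surjection`).

Three points need work. The extension must not depend on the representation of a function in `Y0 E`
(`functionCalculus_eq_of_forall_dualBall`). The convexity inequalities must pass to the completion,
where approximants have to stay positive and, if required, disjoint (`isDConvex_FBL`). Finally, `FBL
D ℓ_1` is separable because it is generated, as a closed vector lattice, by the separable image of
`ℓ_1`. Facts about the function calculus of a Banach lattice rest on `H.induction`. -/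

noncomputable section

namespace FreeBL

open Topology

/-! ### Uniqueness and continuity of the function calculus -/

/-- The linear form with coefficients `b`, as an element of `H m`. -/
def H.form {m : ℕ} (b : Fin m → ℝ) : H m := ∑ i, b i • H.proj i

theorem H.sum_apply {m : ℕ} {ι : Type*} (s : Finset ι) (f : ι → H m) (t : Fin m → ℝ) :
    (∑ i ∈ s, f i : H m) t = ∑ i ∈ s, f i t := by
  classical
  induction s using Finset.induction_on with
  | empty => rfl
  | insert a s ha ih => rw [Finset.sum_insert ha, Finset.sum_insert ha, H.add_apply, ih]

theorem H.form_apply {m : ℕ} (b t : Fin m → ℝ) : H.form b t = ∑ i, b i * t i := by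
  rw [H.form, H.sum_apply]; rfl

theorem H.le_iff {m : ℕ} {f g : H m} : f ≤ g ↔ ∀ t, f t ≤ g t := by
  rw [← sup_eq_right]
  constructor
  · intro h t
    rw [← h]; exact le_sup_left
  · intro h
    exact H.ext' fun t => sup_eq_right.2 (h t)

/-- A property of elements of `H m` which holds for the coordinate projections and is stable under
the vector lattice operations and under uniform approximation holds for all elements. -/
theorem H.induction {m : ℕ} {P : H m → Prop} (zero : P 0) (proj : ∀ k, P (H.proj k))
    (add : ∀ f g, P f → P g → P (f + g)) (smul : ∀ (c : ℝ) f, P f → P (c • f))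
    (sup : ∀ f g, P f → P g → P (f ⊔ g))
    (approx : ∀ h, (∀ ε : ℝ, 0 < ε → ∃ k, P k ∧ ∀ t, |h t - k t| ≤ ε * ∑ i, |t i|) → P h)
    (h : H m) : P h := by
  -- `Rel.dense` refers to a tuple in a Banach lattice. Only the approximating functions matter
  -- here, so the zero tuple in `ℝ` serves.
  have : BanachLattice ℝ := {}
  have hform : ∀ b : Fin m → ℝ, P (H.form b) := fun b =>
    Finset.sum_induction _ P add zero fun i _ => smul _ _ (proj i)
  have hcvx : ∀ (p : H m) (y : ℝ), Cvx (0 : Fin m → ℝ) p y → P p := by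
    rintro p y ⟨B, hBf, hBn, hB, -⟩
    lift B to Finset (Fin m → ℝ) using hBf
    have hne : B.Nonempty := by simpa using hBn
    -- The least upper bounds in `Cvx` are taken at each `t` separately; they assemble to a finite
    -- supremum of linear forms in the lattice `H m`.
    have hp : p = B.sup' hne H.form := by
      have hval : ∀ b t : Fin m → ℝ, Fintype.linearCombination ℝ t b = H.form b t := fun b t => by
        rw [H.form_apply, Fintype.linearCombination_apply]; rfl
      refine H.ext' fun t => le_antisymm ?_ ?_
      · refine (hB t).2 ?_
        rintro _ ⟨b, hb, rfl⟩
        rw [hval]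
        exact H.le_iff.1 (Finset.le_sup' H.form hb) t
      · refine H.le_iff.1 (Finset.sup'_le hne _ fun b hb => H.le_iff.2 fun s => ?_) t
        rw [← hval]
        exact (hB s).1 ⟨b, hb, rfl⟩
    rw [hp]
    exact Finset.sup'_induction hne _ (fun f hf g hg => sup f g hf hg) fun b _ => hform b
  refine approx h fun ε hε => ?_
  obtain ⟨k, z, ⟨p, q, u, v, hp, hq, rfl, -⟩, hk⟩ := Rel.dense (0 : Fin m → ℝ) h hε
  refine ⟨_, ?_, hk⟩
  have := add p ((-1 : ℝ) • q) (hcvx p u hp) (smul _ _ (hcvx q v hq))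
  rwa [H.neg_one_smul', ← sub_eq_add_neg] at this

section Hom

variable {X : Type*} [NormedAddCommGroup X] [NormedSpace ℝ X] [Lattice X] [BanachLattice X] {m : ℕ}

theorem IsLatticeHom.map_le_of_forall {Ψ : H m →ₗ[ℝ] X} (hΨ : IsLatticeHom Ψ) {f g : H m}
    (h : ∀ t, f t ≤ g t) : Ψ f ≤ Ψ g := by
  have : f ⊔ g = g := sup_eq_right.2 (H.le_iff.2 h)
  rw [← this, hΨ.1]
  exact le_sup_left

/-- `H.sumAbs` plays the role of an order unit: positivity of `Ψ` turns the pointwise bound into `|Ψ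
f - Ψ g| ≤ ε • Ψ (H.sumAbs m)`. This automatic continuity handles the `approx` case of every later
use of `H.induction`. -/
theorem IsLatticeHom.norm_sub_le {Ψ : H m →ₗ[ℝ] X} (hΨ : IsLatticeHom Ψ) {f g : H m} {ε : ℝ}
    (hε : 0 ≤ ε) (h : ∀ t, |f t - g t| ≤ ε * ∑ i, |t i|) :
    ‖Ψ f - Ψ g‖ ≤ ε * ‖Ψ (H.sumAbs m)‖ := by
  have h1 : |Ψ f - Ψ g| ≤ |ε • Ψ (H.sumAbs m)| := by
    refine le_trans ?_ (le_abs_self _)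
    rw [← map_sub, ← _root_.map_smul, abs_le', ← map_neg]
    refine ⟨hΨ.map_le_of_forall fun t => ?_, hΨ.map_le_of_forall fun t => ?_⟩
    · rw [H.sub_apply, H.smul_apply, H.sumAbs_apply]
      exact (le_abs_self _).trans (h t)
    · rw [neg_sub, H.sub_apply, H.smul_apply, H.sumAbs_apply]
      rw [← neg_sub]
      exact (neg_le_abs _).trans (h t)
  have := norm_le_norm_of_abs_le_abs h1
  rwa [norm_smul, Real.norm_of_nonneg hε] at this

theorem eq_zero_of_norm_le_mul {a : X} {C : ℝ} (hC : 0 ≤ C)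
    (h : ∀ ε : ℝ, 0 < ε → ‖a‖ ≤ ε * C) : a = 0 := by
  rw [← norm_le_zero_iff]
  refine le_of_forall_pos_le_add fun ε hε => (h (ε / (C + 1)) (by positivity)).trans ?_
  rw [zero_add, div_mul_eq_mul_div, div_le_iff₀ (by positivity)]
  nlinarith

theorem IsLatticeHom.eq_of_proj {Ψ Ψ' : H m →ₗ[ℝ] X} (hΨ : IsLatticeHom Ψ)
    (hΨ' : IsLatticeHom Ψ') (h : ∀ k, Ψ (H.proj k) = Ψ' (H.proj k)) : Ψ = Ψ' := by
  refine LinearMap.ext fun f => ?_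
  induction f using H.induction with
  | zero => simp
  | proj k => exact h k
  | add f g hf hg => rw [map_add, map_add, hf, hg]
  | smul c f hf => rw [_root_.map_smul, _root_.map_smul, hf]
  | sup f g hf hg => rw [hΨ.1, hΨ'.1, hf, hg]
  | approx f happ =>
    rw [← sub_eq_zero]
    refine eq_zero_of_norm_le_mul (C := ‖Ψ (H.sumAbs m)‖ + ‖Ψ' (H.sumAbs m)‖) (by positivity)
      fun ε hε => ?_
    obtain ⟨k, hk, hle⟩ := happ ε hε
    have h1 := hΨ.norm_sub_le hε.le hle
    have h2 := hΨ'.norm_sub_le hε.le hle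
    calc ‖Ψ f - Ψ' f‖ = ‖(Ψ f - Ψ k) - (Ψ' f - Ψ' k)‖ := by rw [hk]; congr 1; abel
      _ ≤ ‖Ψ f - Ψ k‖ + ‖Ψ' f - Ψ' k‖ := _root_.norm_sub_le _ _
      _ ≤ _ := by rw [mul_add]; exact add_le_add h1 h2

/-- The function calculus of a Banach lattice is determined by its values on the projections. -/
theorem IsLatticeHom.eq_functionCalculus {Ψ : H m →ₗ[ℝ] X} (hΨ : IsLatticeHom Ψ) {x : Fin m → X}
    (h : ∀ k, Ψ (H.proj k) = x k) (f : H m) : Ψ f = (functionCalculus X).Φ x f := by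
  rw [hΨ.eq_of_proj ((functionCalculus X).isLatticeHom x) fun k => by
    rw [h, (functionCalculus X).map_proj]]

/-- Suprema suffice, since `H.induction` has no case for infima. This is what confines the free
lattice to a separable sublattice. -/
theorem functionCalculus_mem {W : Submodule ℝ X} (hW : IsClosed (W : Set X))
    (hsup : ∀ a ∈ W, ∀ b ∈ W, a ⊔ b ∈ W) {x : Fin m → X} (hx : ∀ i, x i ∈ W) (h : H m) :
    (functionCalculus X).Φ x h ∈ W := by
  set Φ := (functionCalculus X).Φ x
  have hΦ : IsLatticeHom Φ := (functionCalculus X).isLatticeHom x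
  induction h using H.induction with
  | zero => rw [map_zero]; exact W.zero_mem
  | proj k => rw [show Φ (H.proj k) = x k from (functionCalculus X).map_proj x k]; exact hx k
  | add f g hf hg => rw [map_add]; exact W.add_mem hf hg
  | smul c f hf => rw [_root_.map_smul]; exact W.smul_mem c hf
  | sup f g hf hg => rw [hΦ.1]; exact hsup _ hf _ hg
  | approx f happ =>
    rw [← SetLike.mem_coe, ← hW.closure_eq, Metric.mem_closure_iff]
    intro ε hε
    set C := ‖Φ (H.sumAbs m)‖
    have hC : 0 < C + 1 := by positivity
    -- The summand `1` covers the case `C = 0` and makes the final inequality strict.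
    obtain ⟨k, hk, hle⟩ := happ (ε / (C + 1)) (by positivity)
    refine ⟨Φ k, hk, ?_⟩
    rw [dist_eq_norm]
    refine (hΦ.norm_sub_le (by positivity) hle).trans_lt ?_
    rw [div_mul_eq_mul_div, div_lt_iff₀ hC]
    exact mul_lt_mul_of_pos_left (lt_add_one C) hε

/-- The approximation error at a tuple `y` is proportional to the norm of `Φ y (H.sumAbs m)`, hence
uniform only locally in `y`. Continuity for `H.sumAbs` is therefore established beforehand. -/
theorem continuous_functionCalculus (h : H m) :
    Continuous fun x : Fin m → X => (functionCalculus X).Φ x h := by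
  have hsupc : ∀ f g : H m, (Continuous fun x : Fin m → X => (functionCalculus X).Φ x f) →
      (Continuous fun x : Fin m → X => (functionCalculus X).Φ x g) →
      Continuous fun x : Fin m → X => (functionCalculus X).Φ x (f ⊔ g) := by
    intro f g hf hg
    simp only [((functionCalculus X).isLatticeHom _).1]
    exact hf.sup hg
  have hproj : ∀ k : Fin m, Continuous fun x : Fin m → X => (functionCalculus X).Φ x (H.proj k) := by
    intro k
    simp only [(functionCalculus X).map_proj]
    exact continuous_apply k
  have hS : Continuous fun x : Fin m → X => (functionCalculus X).Φ x (H.sumAbs m) := by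
    simp only [H.sumAbs, map_sum]
    refine continuous_finsetSum _ fun k _ => hsupc _ _ (hproj k) ?_
    simp only [map_neg]
    exact (hproj k).neg
  induction h using H.induction with
  | zero => simp only [map_zero]; exact continuous_const
  | proj k => exact hproj k
  | add f g hf hg => simp only [map_add]; exact hf.add hg
  | smul c f hf => simp only [_root_.map_smul]; exact hf.const_smul c
  | sup f g hf hg => exact hsupc f g hf hg
  | approx f happ =>
    refine continuous_of_locally_uniform_approx_of_continuousAt fun x u hu => ?_
    obtain ⟨ε, hε, hu⟩ := Metric.mem_uniformity_dist.1 hu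
    set C := ‖(functionCalculus X).Φ x (H.sumAbs m)‖
    have hC : 0 < C + 1 := by positivity
    obtain ⟨k, hk, hle⟩ := happ (ε / (C + 1)) (by positivity)
    refine ⟨{y | ‖(functionCalculus X).Φ y (H.sumAbs m)‖ < C + 1},
      (isOpen_lt hS.norm continuous_const).mem_nhds (lt_add_one C), _, hk.continuousAt,
      fun y hy => hu ?_⟩
    rw [dist_eq_norm]
    refine (((functionCalculus X).isLatticeHom y).norm_sub_le (by positivity) hle).trans_lt ?_
    rw [div_mul_eq_mul_div, div_lt_iff₀ hC]
    exact mul_lt_mul_of_pos_left hy hε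

/-! ### Composition in the function calculus and transport along lattice homomorphisms. -/

/-- The composition of an element of `H n` with an `n`-tuple of elements of `H m`. -/
def H.comp {n : ℕ} (h : H n) (g : Fin n → H m) : H m :=
  ⟨⟨fun t => h (fun i => g i t),
      h.1.continuous.comp (continuous_pi fun i => (g i).1.continuous)⟩, fun r hr t => by
    change h (fun i => g i (r • t)) = r * h (fun i => g i t)
    rw [← H.map_smul h hr]
    exact congrArg h.1 (funext fun i => H.map_smul (g i) hr t)⟩

theorem H.comp_apply {n : ℕ} (h : H n) (g : Fin n → H m) (t : Fin m → ℝ) :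
    H.comp h g t = h (fun i => g i t) := rfl

/-- For fixed `g` and `x`, both sides are lattice homomorphisms in `h` with the same values on the
projections, so uniqueness applies. -/
theorem functionCalculus_comp {n : ℕ} (h : H n) (g : Fin n → H m) (x : Fin m → X) :
    (functionCalculus X).Φ x (H.comp h g) =
      (functionCalculus X).Φ (fun i => (functionCalculus X).Φ x (g i)) h := by
  let Ψ : H n →ₗ[ℝ] X :=
    { toFun := fun h => (functionCalculus X).Φ x (H.comp h g)
      map_add' := fun f k => by rw [← map_add]; rfl
      map_smul' := fun c f => by rw [RingHom.id_apply, ← _root_.map_smul]; rfl }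
  have hΨ : IsLatticeHom Ψ :=
    ⟨fun f k => ((functionCalculus X).isLatticeHom x).1 (H.comp f g) (H.comp k g),
      fun f k => ((functionCalculus X).isLatticeHom x).2 (H.comp f g) (H.comp k g)⟩
  exact hΨ.eq_functionCalculus (fun k => rfl) h

theorem functionCalculus_form (b : Fin m → ℝ) (x : Fin m → X) :
    (functionCalculus X).Φ x (H.form b) = ∑ i, b i • x i := by
  simp only [H.form, map_sum, _root_.map_smul, (functionCalculus X).map_proj]

/-- Lattice homomorphisms into a Banach lattice commute with the function calculus. -/
theorem IsLatticeHom.map_functionCalculus {Y : Type*} [AddCommGroup Y] [Module ℝ Y] [Lattice Y]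
    (Φ : FunctionCalculus Y) {T : Y →ₗ[ℝ] X} (hT : IsLatticeHom T) (y : Fin m → Y) (h : H m) :
    T (Φ.Φ y h) = (functionCalculus X).Φ (fun i => T (y i)) h := by
  refine IsLatticeHom.eq_functionCalculus (Ψ := T ∘ₗ Φ.Φ y) ⟨fun f g => ?_, fun f g => ?_⟩
    (fun k => congrArg T (Φ.map_proj y k)) h
  · simp only [LinearMap.comp_apply, (Φ.isLatticeHom y).1, hT.1]
  · simp only [LinearMap.comp_apply, (Φ.isLatticeHom y).2, hT.2]

end Hom

/-! ### Extension of linear maps to the free vector lattice -/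

section Lift

variable {E : Type*} [NormedAddCommGroup E] [NormedSpace ℝ E]

/-- A functional on the finite-dimensional space `F` is continuous and extends by Hahn–Banach. Thus
evaluations of functionals at a basis of `F` reach every coordinate tuple. -/
theorem exists_strongDual_apply_eq {F : Submodule ℝ E} [FiniteDimensional ℝ F] {ι : Type*}
    (b : Module.Basis ι ℝ F) (t : ι → ℝ) : ∃ g : StrongDual ℝ E, ∀ j, g (b j) = t j := by
  obtain ⟨g, hg, -⟩ := _root_.exists_extension_norm_eq F
    (LinearMap.toContinuousLinearMap (b.constr ℝ t))
  exact ⟨g, fun j => by rw [hg]; simp⟩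

/-- Together with positive homogeneity, this carries an identity from the dual ball to the whole
dual. -/
theorem exists_dualBall_smul_eq (g : StrongDual ℝ E) :
    ∃ φ : DualBall E, ∃ r : ℝ, 0 ≤ r ∧ g = r • φ.1 := by
  -- Dividing by `‖g‖ + 1` instead of `‖g‖` avoids a separate case `g = 0`.
  refine ⟨⟨(‖g‖ + 1)⁻¹ • g, ?_⟩, ‖g‖ + 1, by positivity, ?_⟩
  · rw [mem_closedBall_zero_iff, norm_smul, norm_inv, Real.norm_of_nonneg (by positivity),
      inv_mul_le_iff₀ (by positivity)]
    linarith
  · rw [smul_inv_smul₀ (by positivity)]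

variable {X : Type*} [NormedAddCommGroup X] [NormedSpace ℝ X] [Lattice X] [BanachLattice X]
  (T : E →ₗ[ℝ] X)

/-- A function in `Y0 E` determines its image under the lattice homomorphic extension of `T`. -/
theorem functionCalculus_eq_of_forall_dualBall {m n : ℕ} {h : H m} {k : H n} {x : Fin m → E}
    {y : Fin n → E}
    (hyp : ∀ φ : DualBall E, h (fun i => φ.1 (x i)) = k (fun i => φ.1 (y i))) :
    (functionCalculus X).Φ (fun i => T (x i)) h =
      (functionCalculus X).Φ (fun i => T (y i)) k := by
  -- Because of linear relations among the vectors, the hypothesis controls `h` and `k` only on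
  -- certain tuples. Written in a basis of the common span, both sides become functions of the same
  -- independent variables.
  set F : Submodule ℝ E := Submodule.span ℝ (Set.range x ∪ Set.range y) with hF
  have : FiniteDimensional ℝ F :=
    FiniteDimensional.span_of_finite ℝ ((Set.finite_range x).union (Set.finite_range y))
  let b := Module.finBasis ℝ F
  have hx : ∀ i, x i ∈ F := fun i => Submodule.subset_span (Or.inl ⟨i, rfl⟩)
  have hy : ∀ i, y i ∈ F := fun i => Submodule.subset_span (Or.inr ⟨i, rfl⟩)
  have hrepr : ∀ z (hz : z ∈ F), z = ∑ j, b.repr ⟨z, hz⟩ j • (b j : E) := fun z hz => by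
    have := congrArg F.subtype (b.sum_repr ⟨z, hz⟩)
    rw [map_sum] at this
    exact this.symm
  have hT : ∀ z (hz : z ∈ F), T z =
      (functionCalculus X).Φ (fun j => T (b j)) (H.form (b.repr ⟨z, hz⟩)) := fun z hz => by
    rw [functionCalculus_form]
    conv_lhs => rw [hrepr z hz]
    rw [map_sum]
    simp only [_root_.map_smul]
  have hg : ∀ (g : StrongDual ℝ E) z (hz : z ∈ F),
      H.form (b.repr ⟨z, hz⟩) (fun j => g (b j)) = g z := fun g z hz => by
    rw [H.form_apply]
    conv_rhs => rw [hrepr z hz]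
    rw [map_sum]
    simp only [_root_.map_smul, smul_eq_mul]
  simp only [fun i => hT (x i) (hx i), fun i => hT (y i) (hy i)]
  rw [← functionCalculus_comp, ← functionCalculus_comp]
  congr 1
  -- The two composed functions agree everywhere: each `t` is the tuple of values at the basis of
  -- some functional, which is a nonnegative multiple of an element of the dual ball.
  refine H.ext' fun t => ?_
  obtain ⟨g, hgt⟩ := exists_strongDual_apply_eq b t
  obtain ⟨φ, r, hr, rfl⟩ := exists_dualBall_smul_eq g
  have ht : t = fun j => (r • φ.1) (b j) := funext fun j => (hgt j).symm
  rw [H.comp_apply, H.comp_apply, ht]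
  simp only [hg]
  change h (r • fun i => φ.1 (x i)) = k (r • fun i => φ.1 (y i))
  rw [H.map_smul h hr, H.map_smul k hr, hyp]

/-- The extension of `T` to `Y0 E`, as a function. -/
def liftFun (f : Y0 E) : X :=
  (functionCalculus X).Φ (fun i => T (f.2.choose_spec.choose_spec.choose i))
    f.2.choose_spec.choose

theorem liftFun_eq {f : Y0 E} {m : ℕ} {h : H m} {x : Fin m → E}
    (hf : ∀ φ : DualBall E, f.1 φ = h (fun i => φ.1 (x i))) :
    liftFun T f = (functionCalculus X).Φ (fun i => T (x i)) h :=
  functionCalculus_eq_of_forall_dualBall T fun φ =>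
    (f.2.choose_spec.choose_spec.choose_spec φ).symm.trans (hf φ)

theorem liftFun_δ (x : E) : liftFun T (δ x) = T x := by
  rw [liftFun_eq T (h := H.proj 0) (x := ![x]) fun φ => rfl, (functionCalculus X).map_proj]
  rfl

/-- The representations of all `f i` are merged over one concatenated tuple `w`, after which
`functionCalculus_comp` applies. Taking `h` to be a sum, a scalar multiple, a supremum or an infimum
of projections gives linearity and the lattice homomorphism property. -/
theorem liftFun_functionCalculus {n : ℕ} (f : Fin n → Y0 E) (h : H n) :
    liftFun T ((Y0.functionCalculus E).Φ f h) =
      (functionCalculus X).Φ (fun i => liftFun T (f i)) h := by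
  choose m g x hg using fun i => (f i).2
  let w : Fin (∑ i, m i) → E :=
    fun k => x (finSigmaFinEquiv.symm k).1 (finSigmaFinEquiv.symm k).2
  have hw : ∀ i j, w (finSigmaFinEquiv ⟨i, j⟩) = x i j := fun i j => by
    simp only [w]
    rw [Equiv.symm_apply_apply]
  let G : Fin n → H (∑ i, m i) := fun i => H.comp (g i) fun j => H.proj (finSigmaFinEquiv ⟨i, j⟩)
  have hG : ∀ i (φ : DualBall E), (f i).1 φ = G i (fun k => φ.1 (w k)) := fun i φ => by
    rw [hg, H.comp_apply]
    simp only [H.proj_apply, hw]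
  rw [liftFun_eq T (h := H.comp h G) (x := w) fun φ => ?_, functionCalculus_comp]
  · congr 2
    funext i
    exact (liftFun_eq T (hG i)).symm
  · rw [H.comp_apply]
    exact congrArg h.1 (funext fun i => hG i φ)

/-- The lattice homomorphism `Y0 E → X` which maps `δ x` to `T x`. -/
def lift : Y0 E →ₗ[ℝ] X where
  toFun := liftFun T
  map_add' f g := by
    have := liftFun_functionCalculus T ![f, g] (H.proj 0 + H.proj 1)
    rwa [map_add, map_add, (functionCalculus X).map_proj, (functionCalculus X).map_proj,
      (Y0.functionCalculus E).map_proj, (Y0.functionCalculus E).map_proj] at this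
  map_smul' c f := by
    have := liftFun_functionCalculus T ![f] (c • H.proj 0)
    rwa [_root_.map_smul, _root_.map_smul, (functionCalculus X).map_proj,
      (Y0.functionCalculus E).map_proj] at this

theorem isLatticeHom_lift : IsLatticeHom (lift T) := by
  refine ⟨fun f g => ?_, fun f g => ?_⟩
  · have := liftFun_functionCalculus T ![f, g] (H.proj 0 ⊔ H.proj 1)
    rwa [((functionCalculus X).isLatticeHom _).1, ((Y0.functionCalculus E).isLatticeHom _).1,
      (functionCalculus X).map_proj, (functionCalculus X).map_proj,
      (Y0.functionCalculus E).map_proj, (Y0.functionCalculus E).map_proj] at this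
  · have := liftFun_functionCalculus T ![f, g] (H.proj 0 ⊓ H.proj 1)
    rwa [((functionCalculus X).isLatticeHom _).2, ((Y0.functionCalculus E).isLatticeHom _).2,
      (functionCalculus X).map_proj, (functionCalculus X).map_proj,
      (Y0.functionCalculus E).map_proj, (Y0.functionCalculus E).map_proj] at this

theorem IsLatticeHom.map_abs {Y Z : Type*} [AddCommGroup Y] [Module ℝ Y] [Lattice Y]
    [AddCommGroup Z] [Module ℝ Z] [Lattice Z] {S : Y →ₗ[ℝ] Z} (hS : IsLatticeHom S) (y : Y) :
    S |y| = |S y| := by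
  rw [abs, hS.1, map_neg]; rfl

theorem IsLatticeHom.monotone {Y Z : Type*} [AddCommGroup Y] [Module ℝ Y] [Lattice Y]
    [AddCommGroup Z] [Module ℝ Z] [Lattice Z] {S : Y →ₗ[ℝ] Z} (hS : IsLatticeHom S) :
    Monotone S := fun y z h => by
  rw [← sup_eq_right.2 h, hS.1]; exact le_sup_left

variable {T} (D : ConvexityCondition)

/-- If `X` is `D`-convex and `T` is a contraction, the norm of `X` pulls back to an admissible
seminorm. -/
theorem comp_lift_mem_admissible (hX : IsDConvex D X) (hT : ∀ x, ‖T x‖ ≤ ‖x‖) :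
    (normSeminorm ℝ X).comp (lift T) ∈ admissible E D := by
  have hl := isLatticeHom_lift T
  refine ⟨fun f g h => ?_, fun m g hg f hf hdisj => ?_, fun x => ?_⟩
  · refine norm_le_norm_of_abs_le_abs ?_
    rw [← hl.map_abs, ← hl.map_abs]
    exact hl.monotone h
  -- Lattice homomorphisms preserve positivity and disjointness, so the inequality in `X` may be
  -- applied to the images.
  · have h1 := hX m g hg (fun i => lift T (f i)) (fun i => by
      rw [← map_zero (lift T)]; exact hl.monotone (hf i)) (fun h i j hij => by
      rw [← hl.map_abs, ← hl.map_abs, ← hl.2, hdisj h i j hij, map_zero])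
    rw [← hl.map_functionCalculus (Y0.functionCalculus E)] at h1
    exact h1
  · change ‖liftFun T (δ x)‖ ≤ ‖x‖
    rw [liftFun_δ]
    exact hT x

theorem norm_lift_le (hX : IsDConvex D X) (hT : ∀ x, ‖T x‖ ≤ ‖x‖) (f : Y0 E) :
    ‖lift T f‖ ≤ normD D f :=
  le_normD D (comp_lift_mem_admissible D hX hT) f

/-! ### The dense embedding into the completion and the universal property. -/

/-- The canonical embedding of `Y0 E` into `FBL D E`. -/
def toFBL (E : Type*) [NormedAddCommGroup E] [NormedSpace ℝ E] : Y0 E →ₗ[ℝ] FBL D E where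
  toFun f := UniformSpace.Completion.coe' (α := PreFree D E) f
  map_add' f g := UniformSpace.Completion.coe_add (α := PreFree D E) f g
  map_smul' c f := UniformSpace.Completion.coe_smul (X := PreFree D E) c f

theorem isLatticeHom_toFBL : IsLatticeHom (toFBL D E) :=
  ⟨fun f g => coe_sup (X := PreFree D E) f g, fun f g => coe_inf (X := PreFree D E) f g⟩

theorem norm_toFBL (f : Y0 E) : ‖toFBL D E f‖ = normD D f :=
  UniformSpace.Completion.norm_coe (E := PreFree D E) f

theorem denseRange_toFBL : DenseRange (toFBL D E) :=
  UniformSpace.Completion.denseRange_coe (α := PreFree D E)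

theorem normD_δ_le (x : E) : normD D (δ x) ≤ ‖x‖ := normD_le D fun _ hν => hν.2.2 x

/-- The lattice homomorphic extension to `FBL D E` of a contraction from `E` to a `D`-convex Banach
lattice. -/
theorem exists_extension (hX : IsDConvex D X) (hT : ∀ x, ‖T x‖ ≤ ‖x‖) :
    ∃ S : FBL D E →L[ℝ] X, IsLatticeHom S.toLinearMap ∧ (∀ z, ‖S z‖ ≤ ‖z‖) ∧
      ∀ x, S (toFBL D E (δ x)) = T x := by
  let S₀ : PreFree D E →L[ℝ] X :=
    LinearMap.mkContinuous (show PreFree D E →ₗ[ℝ] X from lift T) 1 fun f => by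
      rw [one_mul]; exact norm_lift_le D hX hT f
  let e : PreFree D E →L[ℝ] FBL D E := UniformSpace.Completion.toComplL
  have hed : DenseRange e := UniformSpace.Completion.denseRange_coe
  have heu : IsUniformInducing e := UniformSpace.Completion.isUniformInducing_coe _
  let S : FBL D E →L[ℝ] X := S₀.extend e
  have hS : ∀ f : Y0 E, S (toFBL D E f) = lift T f := fun f => S₀.extend_eq hed heu f
  refine ⟨S, ⟨fun a b => ?_, fun a b => ?_⟩, fun z => ?_, fun x => ?_⟩
  · refine DenseRange.induction_on₂ (p := fun a b => S (a ⊔ b) = S a ⊔ S b)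
      (denseRange_toFBL D) (isClosed_eq (by fun_prop) (by fun_prop)) (fun f g => ?_) a b
    rw [← (isLatticeHom_toFBL D).1, hS, hS, hS, (isLatticeHom_lift T).1]
  · refine DenseRange.induction_on₂ (p := fun a b => S (a ⊓ b) = S a ⊓ S b)
      (denseRange_toFBL D) (isClosed_eq (by fun_prop) (by fun_prop)) (fun f g => ?_) a b
    rw [← (isLatticeHom_toFBL D).2, hS, hS, hS, (isLatticeHom_lift T).2]
  · refine (denseRange_toFBL D).induction_on (p := fun z => ‖S z‖ ≤ ‖z‖) z
      (isClosed_le (by fun_prop) (by fun_prop)) fun f => ?_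
    rw [hS, norm_toFBL]
    exact norm_lift_le D hX hT f
  · rw [hS]
    exact liftFun_δ T x

end Lift

/-! ### `D`-convexity of the free Banach lattice -/

section Convexity

/-- A positive, pairwise disjoint tuple which coincides with `y` if `y` is itself positive and
pairwise disjoint. -/
def disjointify {Y : Type*} [AddCommGroup Y] [Lattice Y] {m : ℕ} (y : Fin m → Y) (i : Fin m) : Y :=
  Finset.univ.inf' (show Finset.univ.Nonempty from ⟨i, Finset.mem_univ i⟩) fun j =>
    if j = i then y i ⊔ 0 else (y i - y j) ⊔ 0

theorem disjointify_nonneg {Y : Type*} [AddCommGroup Y] [Lattice Y] {m : ℕ} (y : Fin m → Y)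
    (i : Fin m) : 0 ≤ disjointify y i := by
  refine Finset.le_inf' _ _ fun j _ => ?_
  split_ifs
  exacts [le_sup_right, le_sup_right]

theorem disjointify_le {Y : Type*} [AddCommGroup Y] [Lattice Y] {m : ℕ} (y : Fin m → Y)
    {i j : Fin m} (hij : i ≠ j) : disjointify y i ≤ (y i - y j) ⊔ 0 := by
  refine (Finset.inf'_le _ (Finset.mem_univ j)).trans_eq ?_
  rw [if_neg hij.symm]

/-- The two entries lie below the positive and the negative part of `y i - y j`, which are disjoint.
-/
theorem disjointify_inf {Y : Type*} [AddCommGroup Y] [Lattice Y] [IsOrderedAddMonoid Y] {m : ℕ}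
    (y : Fin m → Y) {i j : Fin m} (hij : i ≠ j) : disjointify y i ⊓ disjointify y j = 0 := by
  refine le_antisymm ?_ (le_inf (disjointify_nonneg y i) (disjointify_nonneg y j))
  refine (inf_le_inf (disjointify_le y hij) (disjointify_le y hij.symm)).trans_eq ?_
  have := posPart_inf_negPart_eq_zero (y i - y j)
  rwa [posPart_def, negPart_def, neg_sub] at this

theorem disjointify_eq_self {Y : Type*} [AddCommGroup Y] [Lattice Y] [IsOrderedAddMonoid Y] {m : ℕ}
    {y : Fin m → Y} (h0 : ∀ i, 0 ≤ y i) (hd : ∀ i j, i ≠ j → y i ⊓ y j = 0) :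
    disjointify y = y := by
  funext i
  rw [disjointify, Finset.inf'_congr _ rfl (g := fun _ => y i), Finset.inf'_const]
  intro j _
  split_ifs with hj
  · exact sup_eq_left.2 (h0 i)
  -- Disjointness gives `y i ⊔ y j = y i + y j`, so the positive part of `y i - y j`, which is `y i
  -- ⊔ y j - y j`, equals `y i`.
  · have := inf_add_sup (y i) (y j)
    rw [hd i j (Ne.symm hj), zero_add] at this
    rw [← sub_self (y j), ← sup_sub, this, add_sub_cancel_right]

theorem IsLatticeHom.map_disjointify {Y Z : Type*} [AddCommGroup Y] [Module ℝ Y] [Lattice Y]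
    [AddCommGroup Z] [Module ℝ Z] [Lattice Z] {S : Y →ₗ[ℝ] Z} (hS : IsLatticeHom S) {m : ℕ}
    (y : Fin m → Y) (i : Fin m) : S (disjointify y i) = disjointify (fun i => S (y i)) i := by
  rw [disjointify, Finset.apply_inf'_eq_inf'_comp _ S hS.2, disjointify]
  congr 1
  funext j
  rw [Function.comp_apply, apply_ite S, hS.1, hS.1, map_sub, map_zero]

theorem continuous_disjointify {Y : Type*} [AddCommGroup Y] [Lattice Y] [TopologicalSpace Y]
    [ContinuousSup Y] [ContinuousInf Y] [ContinuousSub Y] {m : ℕ} :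
    Continuous (disjointify : (Fin m → Y) → Fin m → Y) := by
  refine continuous_pi fun i => Continuous.finset_inf'_apply _ fun j _ => ?_
  split_ifs
  · exact (continuous_apply i).sup continuous_const
  · exact ((continuous_apply i).sub (continuous_apply j)).sup continuous_const

variable {E : Type*} [NormedAddCommGroup E] [NormedSpace ℝ E] (D : ConvexityCondition)

/-- Each admissible `ν` satisfies the inequality with `ν (f i)` on the right; monotonicity of `g` on
the cone replaces these by the larger norms, and the supremum over `ν` can then be taken. -/
theorem normD_functionCalculus_le {m : ℕ} {g : H m} (hg : (⟨m, g⟩ : Σ m : ℕ, H m) ∈ D.G)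
    {f : Fin m → Y0 E} (hf : ∀ i, 0 ≤ f i)
    (hd : D.ϑ ⟨_, hg⟩ = 0 → ∀ i j, i ≠ j → f i ⊓ f j = 0) :
    normD D ((Y0.functionCalculus E).Φ f g) ≤ D.M ⟨_, hg⟩ * g (fun i => normD D (f i)) := by
  refine normD_le D fun ν hν => (hν.2.1 m g hg f hf fun h i j hij => ?_).trans ?_
  · rw [abs_of_nonneg (hf i), abs_of_nonneg (hf j), hd h i j hij]
  · refine mul_le_mul_of_nonneg_left ?_ (zero_le_one.trans (D.one_le_M _))
    exact D.monotone _ hg _ _ (fun i => apply_nonneg ν _) fun i => le_normD D hν (f i)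

/-- Approximating `x` by tuples from `Y0 E` may destroy positivity and disjointness. Instead the
inequality is proved for `F y` with `y` arbitrary: it is a closed condition in `y`, and on the dense
set of tuples from `Y0 E` it reduces to one for `F₀`, whose values meet the requirements. Finally
`x` is itself a value of `F`. -/
theorem norm_functionCalculus_le_of_retraction {m : ℕ} {g : H m}
    (hg : (⟨m, g⟩ : Σ m : ℕ, H m) ∈ D.G) {F : (Fin m → FBL D E) → Fin m → FBL D E}
    {F₀ : (Fin m → Y0 E) → Fin m → Y0 E} (hF : Continuous F)
    (hFF₀ : ∀ f i, F (fun i => toFBL D E (f i)) i = toFBL D E (F₀ f i))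
    (h0 : ∀ f i, 0 ≤ F₀ f i)
    (hd : D.ϑ ⟨_, hg⟩ = 0 → ∀ f i j, i ≠ j → F₀ f i ⊓ F₀ f j = 0) {x : Fin m → FBL D E}
    (hx : F x = x) :
    ‖(functionCalculus (FBL D E)).Φ x g‖ ≤ D.M ⟨_, hg⟩ * g (fun i => ‖x i‖) := by
  have key : ∀ y : Fin m → FBL D E,
      ‖(functionCalculus (FBL D E)).Φ (F y) g‖ ≤ D.M ⟨_, hg⟩ * g (fun i => ‖F y i‖) := by
    intro y
    have hdense : DenseRange (Pi.map fun _ : Fin m => toFBL D E) :=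
      DenseRange.piMap fun _ => denseRange_toFBL D
    refine hdense.induction_on (p := fun y => ‖(functionCalculus (FBL D E)).Φ (F y) g‖ ≤
      D.M ⟨_, hg⟩ * g (fun i => ‖F y i‖)) y ?_ fun f => ?_
    · refine isClosed_le ((continuous_functionCalculus g).comp hF).norm
        (continuous_const.mul (g.1.continuous.comp (continuous_pi fun i => ?_)))
      exact ((continuous_apply i).comp hF).norm
    · change ‖(functionCalculus (FBL D E)).Φ (F fun i => toFBL D E (f i)) g‖ ≤
        D.M ⟨_, hg⟩ * g (fun i => ‖F (fun i => toFBL D E (f i)) i‖)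
      rw [show (F fun i => toFBL D E (f i)) = fun i => toFBL D E (F₀ f i) from funext (hFF₀ f),
        ← (isLatticeHom_toFBL D).map_functionCalculus (Y0.functionCalculus E)]
      simp only [norm_toFBL]
      exact normD_functionCalculus_le D hg (h0 f) fun h => hd h f
  have := key x
  rwa [hx] at this

theorem isDConvex_FBL (E : Type*) [NormedAddCommGroup E] [NormedSpace ℝ E] :
    IsDConvex D (FBL D E) := by
  intro m g hg x hx hd
  change ‖(functionCalculus (FBL D E)).Φ x g‖ ≤ D.M ⟨_, hg⟩ * g (fun i => ‖x i‖)
  -- Disjoint tuples are fixed by `disjointify`; when disjointness is not required, the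
  -- coordinatewise positive part is enough.
  by_cases hϑ : D.ϑ ⟨_, hg⟩ = 0
  · refine norm_functionCalculus_le_of_retraction D hg continuous_disjointify
      (F₀ := disjointify) (fun f i => ((isLatticeHom_toFBL D).map_disjointify f i).symm)
      disjointify_nonneg (fun _ f i j hij => disjointify_inf f hij)
      (disjointify_eq_self hx fun i j hij => ?_)
    have := hd hϑ i j hij
    rwa [abs_of_nonneg (hx i), abs_of_nonneg (hx j)] at this
  · refine norm_functionCalculus_le_of_retraction D hg (F := fun y i => y i ⊔ 0)
      (F₀ := fun f i => f i ⊔ 0)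
      (continuous_pi fun i => (continuous_apply i).sup continuous_const) (fun f i => ?_)
      (fun f i => le_sup_right) (fun h => absurd h hϑ) (funext fun i => sup_eq_left.2 (hx i))
    rw [(isLatticeHom_toFBL D).1, map_zero]

end Convexity

/-! ### Separability -/

section Separability

open TopologicalSpace

/-- The increasing sequence of subspaces whose union is the sublattice generated by `A`. -/
def latticeSpan {X : Type*} [AddCommGroup X] [Module ℝ X] [Lattice X] (A : Set X) :
    ℕ → Submodule ℝ X
  | 0 => Submodule.span ℝ A
  | n + 1 => Submodule.span ℝ
      ((latticeSpan A n : Set X) ∪ Set.image2 (· ⊔ ·) (latticeSpan A n) (latticeSpan A n))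

/-- A separable set of a Banach lattice is contained in a separable, closed sublattice. -/
theorem exists_separable_sublattice {X : Type*} [NormedAddCommGroup X] [NormedSpace ℝ X] [Lattice X]
    [BanachLattice X] {A : Set X} (hA : IsSeparable A) :
    ∃ W : Submodule ℝ X, A ⊆ W ∧ IsClosed (W : Set X) ∧ (∀ a ∈ W, ∀ b ∈ W, a ⊔ b ∈ W) ∧
      IsSeparable (W : Set X) := by
  let S : ℕ → Submodule ℝ X := latticeSpan A
  have hS : ∀ n, S (n + 1) =
      Submodule.span ℝ ((S n : Set X) ∪ Set.image2 (· ⊔ ·) (S n : Set X) (S n : Set X)) :=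
    fun n => rfl
  have hsep : ∀ n, IsSeparable (S n : Set X) := by
    intro n
    induction n with
    | zero => exact hA.span
    | succ n ih =>
      rw [hS]
      refine (ih.union ?_).span
      rw [← Set.image_prod]
      exact (ih.prod ih).image (continuous_fst.sup continuous_snd)
  have hmono : Monotone S := monotone_nat_of_le_succ fun n => by
    rw [hS]
    exact fun x hx => Submodule.subset_span (Or.inl hx)
  have hcoe : ((⨆ n, S n : Submodule ℝ X) : Set X) = ⋃ n, (S n : Set X) :=
    Submodule.coe_iSup_of_directed S hmono.directed_le
  have hsup : ∀ a ∈ ⨆ n, S n, ∀ b ∈ ⨆ n, S n, a ⊔ b ∈ ⨆ n, S n := by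
    intro a ha b hb
    rw [← SetLike.mem_coe, hcoe, Set.mem_iUnion] at ha hb ⊢
    obtain ⟨i, hi⟩ := ha
    obtain ⟨j, hj⟩ := hb
    refine ⟨max i j + 1, ?_⟩
    rw [hS]
    exact Submodule.subset_span (Or.inr ⟨a, hmono (le_max_left i j) hi, b,
      hmono (le_max_right i j) hj, rfl⟩)
  refine ⟨(⨆ n, S n).topologicalClosure, fun a ha => ?_, Submodule.isClosed_topologicalClosure _,
    fun a ha b hb => ?_, ?_⟩
  · exact Submodule.le_topologicalClosure _ (le_iSup S 0 (Submodule.subset_span ha))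
  · exact map_mem_closure₂ (continuous_fst.sup continuous_snd) ha hb hsup
  · rw [Submodule.topologicalClosure_coe, hcoe]
    exact (isSeparable_iUnion.2 hsep).closure

variable {E : Type*} [NormedAddCommGroup E] [NormedSpace ℝ E] (D : ConvexityCondition)

/-- The map `x ↦ δ_x` from `E` to `FBL D E`. -/
def ofSpace : E →L[ℝ] FBL D E :=
  LinearMap.mkContinuous
    { toFun := fun x => toFBL D E (δ x)
      map_add' := fun x y => by
        rw [← map_add]
        exact congrArg _ (Subtype.ext (funext fun φ => map_add φ.1 x y))
      map_smul' := fun c x => by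
        rw [← _root_.map_smul]
        exact congrArg _ (Subtype.ext (funext fun φ => _root_.map_smul φ.1 c x)) } 1
    fun x => by
      rw [one_mul]
      exact (norm_toFBL D _).trans_le (normD_δ_le D x)

theorem norm_ofSpace_le (x : E) : ‖ofSpace D x‖ ≤ ‖x‖ :=
  (norm_toFBL D _).trans_le (normD_δ_le D x)

/-- A separable closed sublattice containing all `δ_x` contains every `h(δ_{x_1}, …, δ_{x_m})`, and
these are dense. -/
theorem separableSpace_FBL [SeparableSpace E] : SeparableSpace (FBL D E) := by
  obtain ⟨W, hW, hWc, hWs, hsep⟩ := exists_separable_sublattice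
    (isSeparable_range (ofSpace D : E →L[ℝ] FBL D E).continuous)
  refine isSeparable_univ_iff.1 (hsep.mono fun z _ => ?_)
  refine (denseRange_toFBL D).induction_on (p := fun z => z ∈ W) z hWc fun f => ?_
  obtain ⟨m, h, x, hf⟩ := f.2
  have : f = (Y0.functionCalculus E).Φ (fun i => δ (x i)) h := Subtype.ext (funext hf)
  rw [this, (isLatticeHom_toFBL D).map_functionCalculus (Y0.functionCalculus E)]
  exact functionCalculus_mem hWc hWs (fun i => hW ⟨x i, rfl⟩) h

theorem separableSpace_ell1 : SeparableSpace ell1 := by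
  have hsep : IsSeparable (Set.range fun n : ℕ => (lp.single 1 n (1 : ℝ) : ell1)) :=
    (Set.countable_range _).isSeparable
  refine isSeparable_univ_iff.1 (hsep.span (R := ℝ) |>.closure.mono fun x _ => ?_)
  have hsum : HasSum (fun n => (lp.single 1 n (x n) : ell1)) x :=
    lp.hasSum_single ENNReal.one_ne_top x
  refine mem_closure_of_tendsto hsum (Filter.Eventually.of_forall fun s => ?_)
  refine Submodule.sum_mem _ fun n _ => ?_
  have : (lp.single 1 n (x n) : ell1) = x n • (lp.single 1 n (1 : ℝ) : ell1) := by
    rw [← lp.single_smul, smul_eq_mul, mul_one]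
  rw [this]
  exact Submodule.smul_mem _ _ (Submodule.subset_span ⟨n, rfl⟩)

end Separability

/-! ### Quotients -/

section Quotient

/-- If every `y` is approximated by images of vectors of norm at most `‖y‖`, then `T` is a metric
surjection. -/
theorem exists_preimage_norm_le_add {E X : Type*} [NormedAddCommGroup E] [NormedSpace ℝ E]
    [CompleteSpace E] [NormedAddCommGroup X] [NormedSpace ℝ X] (T : E →L[ℝ] X)
    (h : ∀ y : X, ∀ ε : ℝ, 0 < ε → ∃ x : E, ‖x‖ ≤ ‖y‖ ∧ ‖y - T x‖ ≤ ε) (y : X) {ε : ℝ}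
    (hε : 0 < ε) : ∃ x : E, T x = y ∧ ‖x‖ ≤ ‖y‖ + ε := by
  -- These tolerances sum to exactly `ε`.
  let δ : ℕ → ℝ := fun n => ε / 2 / 2 ^ n
  have hδ : ∀ n, 0 < δ n := fun n => by positivity
  choose s hs1 hs2 using h
  -- Successive approximation: `r n` is the remainder after `n` corrections, and `a n` approximately
  -- solves `T (a n) = r n` with `‖a n‖ ≤ ‖r n‖`.
  let r : ℕ → X := fun n => Nat.rec y (fun n z => z - T (s z (δ n) (hδ n))) n
  let a : ℕ → E := fun n => s (r n) (δ n) (hδ n)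
  have hr : ∀ n, r (n + 1) = r n - T (a n) := fun n => rfl
  have hrn : ∀ n, ‖r (n + 1)‖ ≤ δ n := fun n => hs2 _ _ _
  have han : ∀ n, ‖a (n + 1)‖ ≤ δ n := fun n => (hs1 _ _ _).trans (hrn n)
  have hδs : HasSum δ ε := hasSum_geometric_two' ε
  have hsucc : Summable fun n => ‖a (n + 1)‖ :=
    Summable.of_nonneg_of_le (fun _ => norm_nonneg _) han hδs.summable
  have hna : Summable fun n => ‖a n‖ := (summable_nat_add_iff 1).1 hsucc
  have hpart : ∀ n, ∑ i ∈ Finset.range n, T (a i) = y - r n := by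
    intro n
    induction n with
    | zero => simp [r]
    | succ n ih => rw [Finset.sum_range_succ, ih, hr]; abel
  have hr0 : Filter.Tendsto r Filter.atTop (𝓝 0) := by
    rw [← Filter.tendsto_add_atTop_iff_nat 1]
    exact squeeze_zero_norm hrn hδs.summable.tendsto_atTop_zero
  refine ⟨∑' n, a n, ?_, ?_⟩
  · have h1 := (T.hasSum hna.of_norm.hasSum).tendsto_sum_nat
    simp only [hpart] at h1
    refine tendsto_nhds_unique h1 ?_
    simpa using hr0.const_sub y
  · refine (norm_tsum_le_tsum_norm hna).trans ?_
    -- The first correction costs at most `‖y‖`, and all later ones together at most `ε`.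
    rw [hna.tsum_eq_zero_add]
    exact add_le_add (hs1 _ _ _) (hasSum_le han hsucc.hasSum hδs)

end Quotient

/-! ### Quotients by kernels of lattice homomorphisms. -/

section QuotientIsometry

variable {X Z : Type*} [NormedAddCommGroup X] [NormedSpace ℝ X] [Lattice X] [BanachLattice X]
  [NormedAddCommGroup Z] [NormedSpace ℝ Z] [Lattice Z] [BanachLattice Z]

/-- The kernel of a bounded lattice homomorphism is a closed ideal. -/
def kerIdeal (S : Z →L[ℝ] X) (hS : IsLatticeHom S.toLinearMap) : ClosedIdeal Z where
  carrier := LinearMap.ker S.toLinearMap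
  isClosed := S.isClosed_ker
  solid x hx y hyx := by
    have h1 : |S y| ≤ |S x| := by
      have h2 := hS.monotone hyx
      rwa [hS.map_abs, hS.map_abs] at h2
    have hx' : S x = 0 := hx
    have h3 := norm_le_norm_of_abs_le_abs h1
    rw [hx', norm_zero] at h3
    exact norm_le_zero_iff.1 h3

/-- The codomain of a metric surjection which is a lattice homomorphism is lattice isometric to the
quotient by the kernel. -/
theorem isLatticeIsometricToQuotient_of_metric_surjection (S : Z →L[ℝ] X)
    (hS : IsLatticeHom S.toLinearMap) (hle : ∀ z, ‖S z‖ ≤ ‖z‖)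
    (hsurj : ∀ x : X, ∀ ε : ℝ, 0 < ε → ∃ z, S z = x ∧ ‖z‖ ≤ ‖x‖ + ε) :
    IsLatticeIsometricToQuotient X Z := by
  let J := kerIdeal S hS
  let L : J.Quot →ₗ[ℝ] X := J.carrier.liftQ S.toLinearMap le_rfl
  have hL : ∀ z, L (J.proj z) = S z := fun z => rfl
  have hproj_le : ∀ z, ‖J.proj z‖ ≤ ‖z‖ := fun z => Submodule.Quotient.norm_mk_le J.carrier z
  have hnorm : ∀ q, ‖L q‖ = ‖q‖ := by
    refine J.proj_surjective.forall.2 fun z => le_antisymm ?_ ?_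
    -- A representative of almost minimal norm is mapped to the same vector by the contraction `S`.
    · refine le_of_forall_pos_le_add fun ε hε => ?_
      obtain ⟨w, hw, hlt⟩ := Submodule.Quotient.norm_mk_lt (S := J.carrier)
        (Submodule.Quotient.mk z) hε
      have hw' : J.proj w = J.proj z := hw
      rw [← hw', hL]
      refine (hle w).trans (hlt.le.trans_eq ?_)
      rw [hw']; rfl
    -- Conversely, a preimage of `S z` of almost minimal norm represents the same class as `z`.
    · refine le_of_forall_pos_le_add fun ε hε => ?_
      obtain ⟨w, hw, hwle⟩ := hsurj (S z) ε hε
      have : J.proj z = J.proj w := (Submodule.Quotient.eq J.carrier).2 (by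
        change S (z - w) = 0
        rw [map_sub, hw, sub_self])
      rw [hL, this]
      exact (hproj_le w).trans hwle
  have hLsurj : Function.Surjective L := fun x => by
    obtain ⟨z, hz, -⟩ := hsurj x 1 one_pos
    exact ⟨J.proj z, hz⟩
  refine ⟨J, LinearIsometryEquiv.ofSurjective ⟨L, hnorm⟩ hLsurj, ?_, ?_⟩
  · exact J.proj_surjective.forall₂.2 fun a b => hS.1 a b
  · exact J.proj_surjective.forall₂.2 fun a b => hS.2 a b

end QuotientIsometry

/-! ### Separable Banach spaces are metric quotients of `ℓ_1` -/

section Ell1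

variable {X : Type*} [NormedAddCommGroup X] [NormedSpace ℝ X] [CompleteSpace X]

theorem ell1_hasSum_norm (a : ell1) : HasSum (fun n => ‖a n‖) ‖a‖ := by
  have := lp.hasSum_norm (p := 1) (by simp) a
  simpa using this

theorem ell1_summable_smul {u : ℕ → X} (hu : ∀ n, ‖u n‖ ≤ 1) (a : ell1) :
    Summable fun n => ‖a n • u n‖ :=
  Summable.of_nonneg_of_le (fun _ => norm_nonneg _)
    (fun n => by rw [norm_smul]; exact mul_le_of_le_one_right (norm_nonneg _) (hu n))
    (ell1_hasSum_norm a).summable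

/-- The contraction from `ℓ_1` which maps the `n`-th unit vector to `u n`. -/
def ell1Map (u : ℕ → X) (hu : ∀ n, ‖u n‖ ≤ 1) : ell1 →L[ℝ] X :=
  LinearMap.mkContinuous
    { toFun := fun a => ∑' n, a n • u n
      map_add' := fun a b => by
        rw [← (ell1_summable_smul hu a).of_norm.tsum_add (ell1_summable_smul hu b).of_norm]
        exact tsum_congr fun n => add_smul (a n) (b n) (u n)
      map_smul' := fun c a => by
        rw [RingHom.id_apply, ← (ell1_summable_smul hu a).of_norm.tsum_const_smul]
        exact tsum_congr fun n => mul_smul c (a n) (u n) } 1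
    fun a => by
      rw [one_mul]
      refine (norm_tsum_le_tsum_norm (ell1_summable_smul hu a)).trans ?_
      refine hasSum_le (fun n => ?_) (ell1_summable_smul hu a).hasSum (ell1_hasSum_norm a)
      rw [norm_smul]; exact mul_le_of_le_one_right (norm_nonneg _) (hu n)

theorem ell1Map_apply {u : ℕ → X} (hu : ∀ n, ‖u n‖ ≤ 1) (a : ell1) :
    ell1Map u hu a = ∑' n, a n • u n := rfl

theorem norm_ell1Map_le {u : ℕ → X} (hu : ∀ n, ‖u n‖ ≤ 1) (a : ell1) : ‖ell1Map u hu a‖ ≤ ‖a‖ :=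
  ((ell1Map u hu).le_of_opNorm_le (LinearMap.mkContinuous_norm_le _ zero_le_one _) a).trans_eq
    (one_mul _)

theorem ell1Map_single {u : ℕ → X} (hu : ∀ n, ‖u n‖ ≤ 1) (n : ℕ) (c : ℝ) :
    ell1Map u hu (lp.single 1 n c) = c • u n := by
  rw [ell1Map_apply, tsum_eq_single n, lp.single_apply_self]
  intro k hk
  rw [lp.single_apply_ne _ _ _ hk, zero_smul]

/-- The unit vectors are sent to a dense sequence in the unit ball of `X`. A suitable multiple of
one unit vector then solves `T a = y` up to any given error with `‖a‖ = ‖y‖`, and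
`exists_preimage_norm_le_add` removes the error. -/
theorem exists_ell1_metric_surjection (X : Type*) [NormedAddCommGroup X] [NormedSpace ℝ X]
    [CompleteSpace X] [TopologicalSpace.SeparableSpace X] :
    ∃ T : ell1 →L[ℝ] X, (∀ a, ‖T a‖ ≤ ‖a‖) ∧
      ∀ x : X, ∀ ε : ℝ, 0 < ε → ∃ a, T a = x ∧ ‖a‖ ≤ ‖x‖ + ε := by
  have : SecondCountableTopology X := UniformSpace.secondCountable_of_separable X
  let B : Set X := Metric.closedBall 0 1
  have : Nonempty B := ⟨⟨0, by simp [B]⟩⟩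
  let v : ℕ → B := TopologicalSpace.denseSeq B
  have hv : DenseRange v := TopologicalSpace.denseRange_denseSeq B
  have hu : ∀ n, ‖(v n : X)‖ ≤ 1 := fun n => mem_closedBall_zero_iff.1 (v n).2
  refine ⟨ell1Map (fun n => (v n : X)) hu, norm_ell1Map_le hu, fun x ε hε =>
    exists_preimage_norm_le_add _ (fun y ε hε => ?_) x hε⟩
  rcases eq_or_ne y 0 with rfl | hy
  · exact ⟨0, by simp, by simpa using hε.le⟩
  have hpos : 0 < ‖y‖ := norm_pos_iff.2 hy
  let w : B := ⟨‖y‖⁻¹ • y, mem_closedBall_zero_iff.2 (by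
    rw [norm_smul, norm_inv, norm_norm, inv_mul_cancel₀ hpos.ne'])⟩
  -- The error `ε / ‖y‖` for the normalized vector becomes `ε` after scaling back by `‖y‖`.
  obtain ⟨n, hn⟩ := hv.exists_dist_lt w (div_pos hε hpos)
  refine ⟨lp.single 1 n ‖y‖, ?_, ?_⟩
  · rw [lp.norm_single (by simp), norm_norm]
  · rw [ell1Map_single]
    have h1 : ‖‖y‖⁻¹ • y - v n‖ < ε / ‖y‖ := by
      rw [← dist_eq_norm]; exact hn
    have h2 : y - ‖y‖ • (v n : X) = ‖y‖ • (‖y‖⁻¹ • y - v n) := by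
      rw [smul_sub, smul_inv_smul₀ hpos.ne']
    rw [h2, norm_smul, norm_norm, mul_comm]
    exact ((lt_div_iff₀ hpos).1 h1).le

end Ell1

end FreeBL

end

/-! ### Projective universality. -/

theorem theorem4p3 (D : FreeBL.ConvexityCondition) :
    FreeBL.IsProjectivelyUniversal.{u, 0} D (FreeBL.FBL D FreeBL.ell1) := by
  have := FreeBL.separableSpace_ell1
  refine ⟨FreeBL.separableSpace_FBL D, FreeBL.isDConvex_FBL D _, ?_⟩
  intro X _ _ _ _ _ hX
  obtain ⟨T, hT, hTs⟩ := FreeBL.exists_ell1_metric_surjection X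
  obtain ⟨S, hS, hle, hST⟩ := FreeBL.exists_extension D (T := T.toLinearMap) hX hT
  refine FreeBL.isLatticeIsometricToQuotient_of_metric_surjection S hS hle fun x ε hε => ?_
  obtain ⟨a, rfl, ha⟩ := hTs x ε hε
  -- `δ_a` is a preimage of `T a` under `S` of norm at most `‖a‖`, so the bound on preimages carries
  -- over from `T` to `S`.
  exact ⟨FreeBL.ofSpace D a, hST a, (FreeBL.norm_ofSpace_le D a).trans ha⟩
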